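/- Let $M$ be a connected smooth $n$-manifold with a parallelism $w$, i.e. a smooth choice of linear isomorphisms $w(p):\mathbb{R}^n\to T_pM$ ($p\in M$), with components $w^i_{(a)}(x)$ in local coordinates. Put $z(p)=w(p)^{-1}$ (components $z^{(a)}_j(x)$), $\varepsilon(p,q)=w(q)\circ z(p):T_pM\to T_qM$, and $$\Gamma^i_{jk}=z^{(a)}_j\,\frac{\partial w^i_{(a)}}{\partial x^k},\qquad T^i_{jk}=\Gamma^i_{jk}-\Gamma^i_{kj},$$ $$\mathfrak{R}^i_{jk,r}=\widetilde\nabla_rT^i_{jk}=\frac{\partial T^i_{jk}}{\partial x^r}-\Gamma^i_{ar}T^a_{jk}+\Gamma^a_{jr}T^i_{ak}+\Gamma^a_{kr}T^i_{ja}$$ (summation over repeated indices). A tensor field $\alpha$ on $M$ is called $\varepsilon$-invariant if the map of tensors induced by $\varepsilon(p,q)$ takes $\alpha(p)$ to $\alpha(q)$ for all $p,q\in M$. A system $a$ of numbers is the system of structure constants of $\alpha$ if for every $p\in M$ it consists of the components, in the standard basis of $\mathbb{R}^n$, of the tensor obtained from $\alpha(p)$ by $z(p)$. A tensor field $\beta$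 is a tensorial differential invariant (tdi) of $\alpha$ of order $k$, given by the expression $F$, if in every coordinate system of $M$ the components of $\beta$ at each point are the value of one and the same function $F$ at the components of $\alpha$ and their partial derivatives of order at most $k$ at that point. Suppose that $(M,w)$ is a local Lie group, i.e. $\mathfrak{R}=0$, that $\alpha$ is an $\varepsilon$-invariant $(r,s)$-tensor field, and that the $(r',s')$-tensor field $\beta$ is a tdi of $\alpha$ of order $k$, given by $F$. Then $\beta$ is $\varepsilon$-invariant; there are constants $C^{(i)}_{(j)(k)}$ with $$z^{(i)}_a\,T^a_{bc}\,w^b_{(j)}\,w^c_{(k)}=C^{(i)}_{(j)(k)}$$ at all points and in all coordinates, and they are the structure constants of a Lie algebra; $\alpha$ and $\beta$ have structure constants $\hat\alpha$ and $\hat\beta$; and $\hat\beta$ can be expressed in terms of $\hat\alpha$ and $C$, as follows: $$\hat\beta=F\bigl(P(C,\hat\alpha)\bigr),$$ where $P$ is a system of real polynomials in the $C^{(i)}_{(j)(k)}$ and the components of $\hat\alpha$ (one polynomial for each argument of $F$) that depends only on $n,r,s,k$, and not on $r',s',F,M,w,\alpha,\beta$. -/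

import Mathlib

open scoped Manifold ContDiff

noncomputable section

namespace LLG

/-- The model space `ℝⁿ`. -/
abbrev Euc (n : ℕ) : Type := EuclideanSpace ℝ (Fin n)

/-- The `i`-th vector of the standard basis of `ℝⁿ`. -/
def stdVec {n : ℕ} (i : Fin n) : Euc n := EuclideanSpace.single i 1

/-- The `i`-th coordinate form on `ℝⁿ`. -/
def stdCovec {n : ℕ} (i : Fin n) : Module.Dual ℝ (Euc n) := EuclideanSpace.projₗ i

/-! ### Tensors on a vector space -/

/-- Tensors of type `(r, s)` on `V` (`r` contravariant and `s` covariant indices), as functions of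
`r` covectors and `s` vectors, linear in each of them. -/
abbrev Tensor (r s : ℕ) (V : Type*) [AddCommGroup V] [Module ℝ V] : Type _ :=
  MultilinearMap ℝ (fun _ : Fin r => Module.Dual ℝ V) (MultilinearMap ℝ (fun _ : Fin s => V) ℝ)

/-- The map `♮L` on `(r, s)`-tensors that is induced by a linear isomorphism `L : V → W`:
`(♮L t)(θ₁, …, θᵣ)(v₁, …, vₛ) = t(θ₁ ∘ L, …, θᵣ ∘ L)(L⁻¹ v₁, …, L⁻¹ vₛ)`. -/
def Tensor.transport {r s : ℕ} {V W : Type*} [AddCommGroup V] [Module ℝ V] [AddCommGroup W]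
    [Module ℝ W] (L : V ≃ₗ[ℝ] W) (t : Tensor r s V) : Tensor r s W :=
  (MultilinearMap.compLinearMapₗ (fun _ : Fin s => (L.symm : W →ₗ[ℝ] V))).compMultilinearMap
    (t.compLinearMap fun _ => (L : V →ₗ[ℝ] W).dualMap)

/-- Systems of components `t^{i₁ … iᵣ}_{j₁ … jₛ}`, all indices running from `1` to `n`. -/
abbrev Comps (n r s : ℕ) : Type := (Fin r → Fin n) → (Fin s → Fin n) → ℝ

/-- The components of a tensor on `ℝⁿ` in the standard basis. -/
def Tensor.comps {n r s : ℕ} (t : Tensor r s (Euc n)) : Comps n r s :=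
  fun I J => t (fun i => stdCovec (I i)) (fun j => stdVec (J j))

/-! ### Manifolds, charts and tensor fields -/

section Manifold

variable {n : ℕ} {M : Type*} [TopologicalSpace M] [ChartedSpace (Euc n) M]

/-- The coordinate vector `∂/∂xʲ` of the chart `e`, at the point with coordinates `x`. -/
def coordVec (e : OpenPartialHomeomorph M (Euc n)) (x : Euc n) (j : Fin n) :
    TangentSpace (𝓡 n) (e.symm x) :=
  mfderiv (𝓡 n) (𝓡 n) e.symm x (stdVec j)

/-- The coordinate form `dxⁱ` of the chart `e`, at the point with coordinates `x`. -/
def coordForm (e : OpenPartialHomeomorph M (Euc n)) (x : Euc n) (i : Fin n) :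
    Module.Dual ℝ (TangentSpace (𝓡 n) (e.symm x)) :=
  (show TangentSpace (𝓡 n) (e (e.symm x)) →ₗ[ℝ] ℝ from stdCovec i) ∘ₗ
    (mfderiv (𝓡 n) (𝓡 n) e (e.symm x)).toLinearMap

variable (n M) in
/-- A field of `(r, s)`-tensors on `M` (with no regularity imposed). -/
abbrev TensorField (r s : ℕ) : Type _ := (p : M) → Tensor r s (TangentSpace (𝓡 n) p)

/-- The components of a tensor field in the chart `e`, as functions of the coordinates `x`. -/
def TensorField.chartComps {r s : ℕ} (α : TensorField n M r s)
    (e : OpenPartialHomeomorph M (Euc n)) (x : Euc n) : Comps n r s :=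
  fun I J => α (e.symm x) (fun i => coordForm e x (I i)) (fun j => coordVec e x (J j))

end Manifold

/-! ### Tensorial differential invariants -/

/-- The partial derivative `∂f/∂xᵏ`. -/
def partialDeriv {n : ℕ} (k : Fin n) (f : Euc n → ℝ) (x : Euc n) : ℝ := fderiv ℝ f x (stdVec k)

/-- Systems of numbers `t^{i₁ … iᵣ}_{j₁ … jₛ, m₁ … mₗ}`, `0 ≤ l ≤ k`: the type of the components
of a tensor field together with all their partial derivatives of order at most `k`. -/
abbrev Jet (n r s k : ℕ) : Type := (l : Fin (k + 1)) → (Fin l → Fin n) → Comps n r s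

/-- The values at `x` of the functions `f^I_J` and of their partial derivatives
`∂ˡ f^I_J / ∂x^{m₁} … ∂x^{mₗ}` of order `l ≤ k`. -/
def jet {n r s : ℕ} (k : ℕ) (f : Euc n → Comps n r s) (x : Euc n) : Jet n r s k :=
  fun l m I J => iteratedFDeriv ℝ l (fun y => f y I J) x (fun t => stdVec (m t))

section Manifold

variable {n : ℕ} {M : Type*} [TopologicalSpace M] [ChartedSpace (Euc n) M]

/-- `β` is the tensorial differential invariant of `α` of order `k` given by the formula `F`: in
every coordinate system of the smooth manifold `M`, the components of `β` at a point are obtained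
by inserting the components of `α` and their partial derivatives of order at most `k` at this
point into one and the same expression `F`. -/
def IsTdi {r s r' s' : ℕ} (k : ℕ) (F : Jet n r s k → Comps n r' s')
    (α : TensorField n M r s) (β : TensorField n M r' s') : Prop :=
  ∀ e ∈ IsManifold.maximalAtlas (𝓡 n) ∞ M, ∀ x ∈ e.target,
    β.chartComps e x = F (jet k (α.chartComps e) x)

end Manifold

/-! ### Parallelized manifolds -/

/-- The components `w^i_{(a)}(x)` in the chart `e` of a field `w` of linear maps
`ℝⁿ → T_p M`. -/
def frameComp {n : ℕ} {M : Type*} [TopologicalSpace M] [ChartedSpace (Euc n) M]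
    (w : (p : M) → Euc n ≃ₗ[ℝ] TangentSpace (𝓡 n) p) (e : OpenPartialHomeomorph M (Euc n))
    (i a : Fin n) (x : Euc n) : ℝ :=
  coordForm e x i (w (e.symm x) (stdVec a))

/-- A parallelism `w` on the smooth manifold `M`: a smooth choice, for every point `p`, of a linear
isomorphism `w(p) : ℝⁿ → T_p M`. -/
structure Parallelism (n : ℕ) (M : Type*) [TopologicalSpace M] [ChartedSpace (Euc n) M] where
  /-- the isomorphism `w(p)` -/
  w : (p : M) → Euc n ≃ₗ[ℝ] TangentSpace (𝓡 n) p
  smooth : ∀ e ∈ IsManifold.maximalAtlas (𝓡 n) ∞ M, ∀ i a : Fin n,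
    ContDiffOn ℝ ∞ (frameComp w e i a) e.target

namespace Parallelism

variable {n : ℕ} {M : Type*} [TopologicalSpace M] [ChartedSpace (Euc n) M] (w : Parallelism n M)

/-- `z(p) = w(p)⁻¹ : T_p M → ℝⁿ`. -/
def z (p : M) : TangentSpace (𝓡 n) p ≃ₗ[ℝ] Euc n := (w.w p).symm

/-- `ε(p, q) = w(q) ∘ z(p) : T_p M → T_q M`. -/
def eps (p q : M) : TangentSpace (𝓡 n) p ≃ₗ[ℝ] TangentSpace (𝓡 n) q := (w.z p).trans (w.w q)

/-- `ε`-invariance of a tensor field: `♮ε(p, q)` maps `α(p)` to `α(q)`, for all `p` and `q`. -/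
def IsInvariant {r s : ℕ} (α : TensorField n M r s) : Prop :=
  ∀ p q : M, (α p).transport (w.eps p q) = α q

/-- `a` is the system of structure constants of `α`: for every `p`, it consists of the components
of the tensor `♮z_p(α(p))` on `ℝⁿ`. -/
def HasStructureConstants {r s : ℕ} (α : TensorField n M r s) (a : Comps n r s) : Prop :=
  ∀ p : M, ((α p).transport (w.z p)).comps = a

section Chart

variable (e : OpenPartialHomeomorph M (Euc n))

/-- `w^i_{(a)}(x)` -/
def wC (i a : Fin n) (x : Euc n) : ℝ := frameComp w.w e i a x

/-- `z^{(a)}_j(x)` -/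
def zC (a j : Fin n) (x : Euc n) : ℝ := stdCovec a (w.z (e.symm x) (coordVec e x j))

/-- `Γ^i_{jk} = z^{(a)}_j ∂w^i_{(a)}/∂xᵏ` -/
def Gam (i j k : Fin n) (x : Euc n) : ℝ := ∑ a, w.zC e a j x * partialDeriv k (w.wC e i a) x

/-- `T^i_{jk} = Γ^i_{jk} - Γ^i_{kj}` -/
def T (i j k : Fin n) (x : Euc n) : ℝ := w.Gam e i j k x - w.Gam e i k j x

/-- The linear curvature `𝔎^i_{jk,r} = ∇̃_r T^i_{jk}`, where `∇̃` is the first order operator with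
coefficients `Γ` for which the frame is parallel, `∇̃_r ξ^i = ∂ξ^i/∂x^r - Γ^i_{ar} ξ^a`. -/
def curv (i j k r : Fin n) (x : Euc n) : ℝ :=
  partialDeriv r (w.T e i j k) x - ∑ a, w.Gam e i a r x * w.T e a j k x
    + ∑ a, w.Gam e a j r x * w.T e i a k x + ∑ a, w.Gam e a k r x * w.T e i j a x

/-- `z^{(i)}_a T^a_{bc} w^b_{(j)} w^c_{(k)}` -/
def frameT (i j k : Fin n) (x : Euc n) : ℝ :=
  ∑ a, ∑ b, ∑ c, w.zC e i a x * w.T e a b c x * w.wC e b j x * w.wC e c k x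

end Chart

/-- `(M, w)` is a local Lie group: its linear curvature vanishes identically. -/
def IsLocalLieGroup : Prop :=
  ∀ e ∈ IsManifold.maximalAtlas (𝓡 n) ∞ M, ∀ x ∈ e.target, ∀ i j k r : Fin n,
    w.curv e i j k r x = 0

/-- The constants `C^{(i)}_{(j)(k)}` are the components of the bilinear maps
`T(p) : T_p M × T_p M → T_p M` in the frame `w(p)`, for every point `p`. -/
def HasLieConstants (C : Fin n → Fin n → Fin n → ℝ) : Prop :=
  ∀ e ∈ IsManifold.maximalAtlas (𝓡 n) ∞ M, ∀ x ∈ e.target, ∀ i j k : Fin n,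
    w.frameT e i j k x = C i j k

end Parallelism

/-- `[e_j, e_k] = C^i_{jk} e_i` defines a Lie algebra structure on `ℝⁿ`. -/
def IsLieAlgebra {n : ℕ} (C : Fin n → Fin n → Fin n → ℝ) : Prop :=
  (∀ i j k, C i j k = -C i k j) ∧
    ∀ i j k l, ∑ m, (C m j k * C i m l + C m k l * C i m j + C m l j * C i m k) = 0

/-! ### Universal polynomial expressions -/

/-- Variables: one for each constant `C^i_{jk}` and one for each component `a^I_J` of an
`(r, s)`-tensor. -/
abbrev Vars (n r s : ℕ) : Type :=
  (Fin n × Fin n × Fin n) ⊕ ((Fin r → Fin n) × (Fin s → Fin n))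

/-- A system of polynomials in these variables, one for each entry of a `k`-jet. -/
abbrev PolyJet (n r s k : ℕ) : Type :=
  (l : Fin (k + 1)) → (Fin l → Fin n) → (Fin r → Fin n) → (Fin s → Fin n) →
    MvPolynomial (Vars n r s) ℝ

/-- The jet obtained by giving the variables the values `C^i_{jk}` and `a^I_J`. -/
def PolyJet.eval {n r s k : ℕ} (P : PolyJet n r s k) (C : Fin n → Fin n → Fin n → ℝ)
    (a : Comps n r s) : Jet n r s k :=
  fun l m I J => MvPolynomial.eval
    (Sum.elim (fun v => C v.1 v.2.1 v.2.2) (fun v => a v.1 v.2)) (P l m I J)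

end LLG

end

/-! Write Z for the matrix of the coframe z in a chart. Frame and coframe are parallel for ∇̃, so
the derivatives of the frame components of T are the frame components of 𝔎 = 0
(`partialDeriv_frameT`). These components do not depend on the chart, hence on the connected M they
are constants C. They are also the values of dZ on the frame (`frameT_eq`), so Z satisfies the
Maurer–Cartan equation dZ(u, v) = C(Zu, Zv); differentiating it once more and using d² = 0 gives the
Jacobi identity.

Around every point p there is a chart centred at p with Z(0) = 1 in which Z(y)y - y vanishes to
order k + 2. Instead of integrating one-parameter groups, the error is removed one order at a time
(`vanishesTo_radial_step`). Contracting the Maurer–Cartan equation with the position vector then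
gives a linear radial equation whose solution is unique to finite order, so modulo order k + 1 the
matrix Z is the truncated series of (exp ad y - 1)/ad y (`vanishesTo_sub_expQuot`), and the frame is
its truncated inverse.

Hence the k-jet of α at the origin of this chart consists of universal polynomials in C and the
structure constants of α (`jet_chartComps`). Since Z(0) = 1, the chart components of β there are its
components in the frame, and the tdi property makes them F(P(C, α̂)). This value is the same for
every p, which gives at once the formula and the invariance of β. -/

namespace LLG

open Filter Topology

/-! ### Functions vanishing to a given order at the origin -/

section Vanishing

universe u

variable {E F G H : Type u} [NormedAddCommGroup E] [NormedSpace ℝ E]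
  [NormedAddCommGroup F] [NormedSpace ℝ F] [NormedAddCommGroup G] [NormedSpace ℝ G]
  [NormedAddCommGroup H] [NormedSpace ℝ H]

/-- All derivatives of `f` of order less than `m` vanish at the origin. -/
def VanishesTo (m : ℕ) (f : E → F) : Prop := ∀ l < m, iteratedFDeriv ℝ l f 0 = 0

theorem vanishesTo_zero (f : E → F) : VanishesTo 0 f := fun _ h => absurd h (Nat.not_lt_zero _)

/-- The recursion behind every order estimate below: differentiate once and apply the induction
hypothesis to the derivative, which takes values in a new space. -/
theorem vanishesTo_succ_iff {m : ℕ} {f : E → F} :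
    VanishesTo (m + 1) f ↔ f 0 = 0 ∧ VanishesTo m (fderiv ℝ f) := by
  constructor
  · intro h
    refine ⟨?_, fun l hl => ?_⟩
    · have := h 0 (Nat.succ_pos _)
      rw [← norm_eq_zero, norm_iteratedFDeriv_zero, norm_eq_zero] at this
      exact this
    · rw [← norm_eq_zero, norm_iteratedFDeriv_fderiv, h (l + 1) (by omega), norm_zero]
  · rintro ⟨h0, h1⟩ l hl
    cases l with
    | zero => rw [← norm_eq_zero, norm_iteratedFDeriv_zero, h0, norm_zero]
    | succ l => rw [← norm_eq_zero, ← norm_iteratedFDeriv_fderiv, h1 l (by omega), norm_zero]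

theorem vanishesTo_one {f : E → F} (h : f 0 = 0) : VanishesTo 1 f :=
  vanishesTo_succ_iff.2 ⟨h, vanishesTo_zero _⟩

namespace VanishesTo

variable {m l : ℕ} {f g : E → F}

theorem apply_zero (h : VanishesTo (m + 1) f) : f 0 = 0 := (vanishesTo_succ_iff.1 h).1

theorem mono (h : VanishesTo m f) (hl : l ≤ m) : VanishesTo l f :=
  fun i hi => h i (hi.trans_le hl)

theorem fderiv (h : VanishesTo m f) : VanishesTo (m - 1) (fderiv ℝ f) := by
  cases m with
  | zero => exact vanishesTo_zero _
  | succ m => exact (vanishesTo_succ_iff.1 h).2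

theorem congr (h : VanishesTo m f) (hfg : f =ᶠ[𝓝 0] g) : VanishesTo m g := fun i hi => by
  rw [← (hfg.iteratedFDeriv ℝ i).eq_of_nhds, h i hi]

theorem add (hf : VanishesTo m f) (hg : VanishesTo m g) (cf : ContDiffAt ℝ ∞ f 0)
    (cg : ContDiffAt ℝ ∞ g 0) : VanishesTo m (fun x => f x + g x) := fun i hi => by
  have := iteratedFDeriv_add_apply (i := i) (cf.of_le (by exact_mod_cast le_top))
    (cg.of_le (by exact_mod_cast le_top))
  rw [hf i hi, hg i hi, add_zero] at this
  exact this

theorem const_smul (hf : VanishesTo m f) (cf : ContDiffAt ℝ ∞ f 0) (a : ℝ) :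
    VanishesTo m (fun x => a • f x) := fun i hi => by
  have := iteratedFDeriv_const_smul_apply' (i := i) (a := a) (cf.of_le (by exact_mod_cast le_top))
  rw [this, hf i hi, smul_zero]

theorem sub (hf : VanishesTo m f) (hg : VanishesTo m g) (cf : ContDiffAt ℝ ∞ f 0)
    (cg : ContDiffAt ℝ ∞ g 0) : VanishesTo m (fun x => f x - g x) := by
  simpa [sub_eq_add_neg] using hf.add (hg.const_smul cg (-1)) cf (contDiffAt_const.smul cg)

theorem clm_apply_left (hf : VanishesTo m f) (cf : ContDiffAt ℝ ∞ f 0) (L : F →L[ℝ] G) :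
    VanishesTo m (fun x => L (f x)) := fun i hi => by
  have := L.iteratedFDeriv_comp_left (i := i) (cf.of_le (show ((i : ℕ∞) : WithTop ℕ∞) ≤ ∞ by exact_mod_cast le_top)) le_rfl
  rw [hf i hi] at this
  refine this.trans ?_
  ext
  simp

end VanishesTo

theorem contDiffAt_fderiv {f : E → F} {x : E} (cf : ContDiffAt ℝ ∞ f x) :
    ContDiffAt ℝ ∞ (fderiv ℝ f) x := cf.fderiv_right (by exact_mod_cast le_top)

theorem ContDiffAt.eventually_differentiableAt {f : E → F} {x : E} (cf : ContDiffAt ℝ ∞ f x) :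
    ∀ᶠ y in 𝓝 x, DifferentiableAt ℝ f y :=
  ((cf.of_le (show (1 : WithTop ℕ∞) ≤ ∞ by exact_mod_cast le_top)).eventually (by simp)).mono
    fun _ h => h.differentiableAt (by simp)

/-- The order of vanishing is additive in products. -/
theorem VanishesTo.bilinear {m l : ℕ} {f : E → F} {g : E → G} (B : F →L[ℝ] G →L[ℝ] H)
    (hf : VanishesTo m f) (hg : VanishesTo l g) (cf : ContDiffAt ℝ ∞ f 0)
    (cg : ContDiffAt ℝ ∞ g 0) : VanishesTo (m + l) (fun x => B (f x) (g x)) := by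
  -- By the Leibniz rule the induction moves to maps into spaces of operators, so all target spaces
  -- are quantified inside it. The bound `K ≤ m + l` replaces an equality so that the truncated `m -
  -- 1` and `l - 1` do no harm.
  suffices key : ∀ (K : ℕ) (F G H : Type u) [NormedAddCommGroup F] [NormedSpace ℝ F]
      [NormedAddCommGroup G] [NormedSpace ℝ G] [NormedAddCommGroup H] [NormedSpace ℝ H]
      (B : F →L[ℝ] G →L[ℝ] H) (m l : ℕ) (f : E → F) (g : E → G), K ≤ m + l → VanishesTo m f →
      VanishesTo l g → ContDiffAt ℝ ∞ f 0 → ContDiffAt ℝ ∞ g 0 →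
      VanishesTo K (fun x => B (f x) (g x)) from key _ F G H B m l f g le_rfl hf hg cf cg
  clear hf hg cf cg B f g m l
  intro K
  induction K with
  | zero => intros; exact vanishesTo_zero _
  | succ K ih =>
    intro F G H _ _ _ _ _ _ B m l f g hK hf hg cf cg
    refine vanishesTo_succ_iff.2 ⟨?_, ?_⟩
    · rcases Nat.eq_zero_or_pos m with rfl | hm
      · obtain ⟨l, rfl⟩ : ∃ l', l = l' + 1 := ⟨l - 1, by omega⟩
        simp [hg.apply_zero]
      · obtain ⟨m, rfl⟩ : ∃ l', m = l' + 1 := ⟨m - 1, by omega⟩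
        simp [hf.apply_zero]
    · have h1 := ih _ _ _ (B.precompR E) m (l - 1) f _ (by omega) hf hg.fderiv cf
        (contDiffAt_fderiv cg)
      have h2 := ih _ _ _ (B.precompL E) (m - 1) l _ g (by omega) hf.fderiv hg
        (contDiffAt_fderiv cf) cg
      refine (h1.add h2 ?_ ?_).congr ?_
      · exact ((B.precompR E).contDiff.contDiffAt.comp _ cf).clm_apply (contDiffAt_fderiv cg)
      · exact ((B.precompL E).contDiff.contDiffAt.comp _ (contDiffAt_fderiv cf)).clm_apply cg
      · filter_upwards [ContDiffAt.eventually_differentiableAt cf,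
          ContDiffAt.eventually_differentiableAt cg] with y hy hy'
        exact (B.fderiv_of_bilinear hy hy').symm

theorem VanishesTo.clm_apply {m l : ℕ} {f : E → F →L[ℝ] G} {g : E → F} (hf : VanishesTo m f)
    (hg : VanishesTo l g) (cf : ContDiffAt ℝ ∞ f 0) (cg : ContDiffAt ℝ ∞ g 0) :
    VanishesTo (m + l) (fun x => f x (g x)) :=
  VanishesTo.bilinear (ContinuousLinearMap.id ℝ (F →L[ℝ] G)) hf hg cf cg

theorem VanishesTo.clm_comp {m l : ℕ} {f : E → G →L[ℝ] H} {g : E → F →L[ℝ] G}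
    (hf : VanishesTo m f) (hg : VanishesTo l g) (cf : ContDiffAt ℝ ∞ f 0)
    (cg : ContDiffAt ℝ ∞ g 0) : VanishesTo (m + l) (fun x => (f x).comp (g x)) :=
  VanishesTo.bilinear (ContinuousLinearMap.compL ℝ F G H) hf hg cf cg

theorem VanishesTo.comp {m : ℕ} {f : E → F} {φ : E → E} (hf : VanishesTo m f)
    (cf : ContDiffAt ℝ ∞ f 0) (cφ : ContDiffAt ℝ ∞ φ 0) (h0 : φ 0 = 0) :
    VanishesTo m (fun x => f (φ x)) := by
  induction m generalizing F with
  | zero => exact vanishesTo_zero _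
  | succ m ih =>
    refine vanishesTo_succ_iff.2 ⟨by rw [h0, hf.apply_zero], ?_⟩
    have cf' : ContDiffAt ℝ ∞ f (φ 0) := h0.symm ▸ cf
    have cff := (contDiffAt_fderiv cf').comp 0 cφ
    have := (ih hf.fderiv (contDiffAt_fderiv cf)).clm_comp
      (vanishesTo_zero (_root_.fderiv ℝ φ)) cff (contDiffAt_fderiv cφ)
    refine this.congr ?_
    filter_upwards [cφ.continuousAt.eventually (ContDiffAt.eventually_differentiableAt cf'),
      ContDiffAt.eventually_differentiableAt cφ] with y hy hy'
    exact (fderiv_comp y hy hy').symm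

/-- The Euler operator acts on the leading part of a function vanishing to order `m` as
multiplication by `m`. -/
theorem VanishesTo.euler {m : ℕ} {f : E → F} (hf : VanishesTo m f) (cf : ContDiffAt ℝ ∞ f 0) :
    VanishesTo (m + 1) (fun x => _root_.fderiv ℝ f x x - (m : ℝ) • f x) := by
  induction m generalizing F with
  | zero => exact vanishesTo_one (by simp)
  | succ m ih =>
    refine vanishesTo_succ_iff.2 ⟨by simp [hf.apply_zero], ?_⟩
    refine (ih hf.fderiv (contDiffAt_fderiv cf)).congr ?_
    have c2 : ContDiffAt ℝ 2 f 0 := cf.of_le (WithTop.coe_le_coe.2 le_top)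
    filter_upwards [ContDiffAt.eventually_differentiableAt cf,
      ContDiffAt.eventually_differentiableAt (contDiffAt_fderiv cf),
      c2.eventually (by simp)] with y h1 h2 h3
    have hd := ((h2.hasFDerivAt.clm_apply (hasFDerivAt_id y)).sub
      (h1.hasFDerivAt.const_smul ((m + 1 : ℕ) : ℝ))).fderiv
    refine Eq.trans ?_ hd.symm
    ext v
    -- Symmetry of D²f turns the derivative of Df(y)y into D²f(y)y + Df(y); the extra Df lowers the
    -- factor m + 1 to m.
    have hs : IsSymmSndFDerivAt ℝ f y := h3.isSymmSndFDerivAt (by simp)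
    have := hs.eq v y
    simp [this]
    module

/-- A substitution tangent to the identity does not change the leading part. Inductively, D(h ∘ φ) -
Dh is the sum of (Dh) ∘ φ - Dh and ((Dh) ∘ φ) · D(φ - id), and the second term gains an order from
D(φ - id). -/
theorem VanishesTo.comp_sub {m : ℕ} {h : E → F} {φ : E → E} (hh : VanishesTo m h)
    (ch : ContDiffAt ℝ ∞ h 0) (cφ : ContDiffAt ℝ ∞ φ 0)
    (hφ : VanishesTo 2 (fun x => φ x - x)) :
    VanishesTo (m + 1) (fun x => h (φ x) - h x) := by
  have h0 : φ 0 = 0 := by simpa using hφ.apply_zero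
  induction m generalizing F with
  | zero => exact vanishesTo_one (by simp [h0])
  | succ m ih =>
    refine vanishesTo_succ_iff.2 ⟨by simp [h0], ?_⟩
    have ch' : ContDiffAt ℝ ∞ h (φ 0) := h0.symm ▸ ch
    have chφ := (contDiffAt_fderiv ch').comp 0 cφ
    have cid : ContDiffAt ℝ ∞ (fun x => φ x - x) 0 := cφ.sub contDiffAt_id
    have h1 := ih hh.fderiv (contDiffAt_fderiv ch)
    have h2 := (hh.fderiv.comp (contDiffAt_fderiv ch) cφ h0).clm_comp hφ.fderiv chφ
      (contDiffAt_fderiv cid)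
    refine (h1.add h2 (chφ.sub (contDiffAt_fderiv ch))
      (chφ.clm_comp (contDiffAt_fderiv cid))).congr ?_
    filter_upwards [cφ.continuousAt.eventually (ContDiffAt.eventually_differentiableAt ch'),
      ContDiffAt.eventually_differentiableAt cφ,
      ContDiffAt.eventually_differentiableAt ch] with y h1 h2 h3
    have e1 := ((h1.hasFDerivAt.comp y h2.hasFDerivAt).sub h3.hasFDerivAt).fderiv
    have e2 := (h2.hasFDerivAt.sub (hasFDerivAt_id y)).fderiv
    refine Eq.trans ?_ e1.symm
    change _ + (_root_.fderiv ℝ h (φ y)).comp (_root_.fderiv ℝ (φ - id) y) = _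
    rw [e2]
    ext v
    simp

/-! ### Radial coordinates to finite order -/

/-- One step of the normalisation: if `Z y y - y` vanishes to order `m + 2`, it does so to order
`m + 3` after the change of coordinates `y ↦ y - (Z y y - y) / (m + 2)`. -/
theorem vanishesTo_radial_step {Z : E → E →L[ℝ] E} (cZ : ContDiffAt ℝ ∞ Z 0)
    (hZ0 : Z 0 = ContinuousLinearMap.id ℝ E) (m : ℕ)
    (hm : VanishesTo (m + 2) (fun y => Z y y - y)) {ψ : E → E}
    (hψ : ψ = fun y => y - (1 / (m + 2 : ℝ)) • (Z y y - y)) :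
    ψ 0 = 0 ∧ fderiv ℝ ψ 0 = ContinuousLinearMap.id ℝ E ∧
      VanishesTo (m + 3) (fun y => Z (ψ y) (fderiv ℝ ψ y y) - y) := by
  set h : E → E := fun y => Z y y - y with hdef
  have ch : ContDiffAt ℝ ∞ h 0 := (cZ.clm_apply contDiffAt_id).sub contDiffAt_id
  have cψ : ContDiffAt ℝ ∞ ψ 0 := by
    rw [hψ]; exact contDiffAt_id.sub (contDiffAt_const.smul ch)
  have h0 : ψ 0 = 0 := by rw [hψ]; simp
  have hsub : VanishesTo (m + 2) (fun y => ψ y - y) := by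
    refine (hm.const_smul ch (-(1 / (m + 2 : ℝ)))).congr (Eventually.of_forall fun y => ?_)
    simp [hψ, hdef]
  have hd : ∀ᶠ y in 𝓝 (0 : E), fderiv ℝ ψ y =
      ContinuousLinearMap.id ℝ E - (1 / (m + 2 : ℝ)) • fderiv ℝ h y := by
    filter_upwards [ContDiffAt.eventually_differentiableAt ch] with y hy
    rw [hψ]
    exact ((hasFDerivAt_id y).sub (hy.hasFDerivAt.const_smul _)).fderiv
  have hh0 : fderiv ℝ h 0 = 0 := by
    have := hm.fderiv
    exact this.apply_zero (m := m)
  have cZψ : ContDiffAt ℝ ∞ (fun y => Z (ψ y)) 0 :=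
    ContDiffAt.comp 0 (by rw [h0]; exact cZ) cψ
  have chψ : ContDiffAt ℝ ∞ (fun y => h (ψ y)) 0 :=
    ContDiffAt.comp (g := h) 0 (by rw [h0]; exact ch) cψ
  refine ⟨h0, by rw [hd.self_of_nhds, hh0]; simp, ?_⟩
  -- With c = 1/(m + 2), the new error Z(ψ)(Dψ y) - y equals (h(ψ) - h) + (c - 1)(Z(ψ) - 1)h - c
  -- Z(ψ)(Dh y - (m + 2)h). Each summand has order m + 3; the last by Euler's relation, which
  -- dictates the value of c.
  have e1 : VanishesTo (m + 3) (fun y => h (ψ y) - h y) :=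
    hm.comp_sub ch cψ (hsub.mono (by omega))
  have cZ1 : ContDiffAt ℝ ∞ (fun y => Z (ψ y) - ContinuousLinearMap.id ℝ E) 0 :=
    cZψ.sub contDiffAt_const
  have e2 : VanishesTo (1 + (m + 2)) (fun y => (Z (ψ y) - ContinuousLinearMap.id ℝ E) (h y)) :=
    (vanishesTo_one (by simp [h0, hZ0])).clm_apply hm cZ1 ch
  have ceu : ContDiffAt ℝ ∞ (fun y => fderiv ℝ h y y - ((m + 2 : ℕ) : ℝ) • h y) 0 :=
    ((contDiffAt_fderiv ch).clm_apply contDiffAt_id).sub (contDiffAt_const.smul ch)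
  have e3 : VanishesTo (0 + (m + 3))
      (fun y => Z (ψ y) (fderiv ℝ h y y - ((m + 2 : ℕ) : ℝ) • h y)) :=
    (vanishesTo_zero _).clm_apply (hm.euler ch) cZψ ceu
  rw [zero_add] at e3
  rw [add_comm 1] at e2
  have c2 := cZ1.clm_apply ch
  have c3 := cZψ.clm_apply ceu
  have := (e1.add (e2.const_smul c2 (1 / (m + 2 : ℝ) - 1)) (chψ.sub ch)
    (contDiffAt_const.smul c2)).add (e3.const_smul c3 (-(1 / (m + 2 : ℝ))))
    ((chψ.sub ch).add (contDiffAt_const.smul c2)) (contDiffAt_const.smul c3)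
  refine this.congr ?_
  filter_upwards [hd] with y hy
  rw [hy]
  have k1 : Z (ψ y) (ψ y) = h (ψ y) + ψ y := by simp [hdef]
  have k2 : y = ψ y + (1 / (m + 2 : ℝ)) • h y := by simp [hψ, hdef]
  have k3 : (ContinuousLinearMap.id ℝ E - (1 / (m + 2 : ℝ)) • fderiv ℝ h y) y =
      ψ y + (1 / (m + 2 : ℝ)) • h y - (1 / (m + 2 : ℝ)) • fderiv ℝ h y y := by
    rw [← k2]; simp
  rw [k3]
  simp only [map_sub, map_add, map_smul, sub_apply, ContinuousLinearMap.id_apply, k1]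
  have hne : (m + 2 : ℝ) ≠ 0 := by positivity
  have k4 : ψ y = y - (1 / (m + 2 : ℝ)) • h y := eq_sub_of_add_eq k2.symm
  generalize h (ψ y) = a
  generalize Z (ψ y) (h y) = b
  generalize Z (ψ y) (fderiv ℝ h y y) = c
  rw [k4]
  generalize h y = d
  push_cast
  match_scalars <;> field_simp <;> ring

/-- Coordinates in which a field of linear maps `Z` is radial to a given order. -/
theorem exists_radial {Z : E → E →L[ℝ] E} (cZ : ∀ᶠ y in 𝓝 (0 : E), ContDiffAt ℝ ∞ Z y)
    (hZ0 : Z 0 = ContinuousLinearMap.id ℝ E) (m : ℕ) :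
    ∃ φ : E → E, (∀ᶠ y in 𝓝 (0 : E), ContDiffAt ℝ ∞ φ y) ∧ φ 0 = 0 ∧
      fderiv ℝ φ 0 = ContinuousLinearMap.id ℝ E ∧
      VanishesTo (m + 2) (fun y => Z (φ y) (fderiv ℝ φ y y) - y) := by
  induction m with
  | zero =>
    refine ⟨id, Eventually.of_forall fun y => contDiffAt_id, rfl, fderiv_id, ?_⟩
    -- Order 2 is free: Z(y)y - y = (Z(y) - 1)y is a product of two factors of order 1.
    have c1 : ContDiffAt ℝ ∞ (fun y => Z y - ContinuousLinearMap.id ℝ E) 0 :=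
      cZ.self_of_nhds.sub contDiffAt_const
    have := (vanishesTo_one (f := fun y => Z y - ContinuousLinearMap.id ℝ E)
      (by simp [hZ0])).clm_apply (vanishesTo_one (f := (id : E → E)) rfl) c1 contDiffAt_id
    refine this.congr (Eventually.of_forall fun y => ?_)
    simp
  | succ m ih =>
    obtain ⟨φ, cφ, h0, hd, hv⟩ := ih
    -- `Y` is the pull-back of the one-form Z by φ, and the normalising step applies to it.
    set Y : E → E →L[ℝ] E := fun y => (Z (φ y)).comp (fderiv ℝ φ y) with hY
    have cφ0 := cφ.self_of_nhds
    have hcont : Tendsto φ (𝓝 0) (𝓝 0) := by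
      have := cφ0.continuousAt.tendsto
      rwa [h0] at this
    have cY : ∀ᶠ y in 𝓝 (0 : E), ContDiffAt ℝ ∞ Y y := by
      filter_upwards [cφ, hcont.eventually cZ] with y h1 h2
      exact (h2.comp y h1).clm_comp (contDiffAt_fderiv h1)
    have hY0 : Y 0 = ContinuousLinearMap.id ℝ E := by simp [hY, h0, hZ0, hd]
    obtain ⟨ψ, hψ⟩ : ∃ ψ : E → E, ψ = fun y => y - (1 / (m + 2 : ℝ)) • (Y y y - y) := ⟨_, rfl⟩
    obtain ⟨p0, pd, pv⟩ := vanishesTo_radial_step cY.self_of_nhds hY0 m hv hψ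
    have cψ : ∀ᶠ y in 𝓝 (0 : E), ContDiffAt ℝ ∞ ψ y := by
      filter_upwards [cY] with y h1
      rw [hψ]
      exact contDiffAt_id.sub (contDiffAt_const.smul ((h1.clm_apply contDiffAt_id).sub contDiffAt_id))
    have hcont' : Tendsto ψ (𝓝 0) (𝓝 0) := by
      have := cψ.self_of_nhds.continuousAt.tendsto
      rwa [p0] at this
    have hch : ∀ᶠ y in 𝓝 (0 : E), ContDiffAt ℝ ∞ φ (ψ y) ∧ ContDiffAt ℝ ∞ ψ y :=
      (hcont'.eventually cφ).and cψ
    have hfd : ∀ᶠ y in 𝓝 (0 : E),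
        fderiv ℝ (fun y => φ (ψ y)) y = (fderiv ℝ φ (ψ y)).comp (fderiv ℝ ψ y) := by
      filter_upwards [hch] with y hy
      exact fderiv_comp y (hy.1.differentiableAt (by simp)) (hy.2.differentiableAt (by simp))
    refine ⟨fun y => φ (ψ y), ?_, by simp [p0, h0], ?_, ?_⟩
    · filter_upwards [hch] with y hy
      exact hy.1.comp y hy.2
    · rw [hfd.self_of_nhds, p0, pd, hd]; rfl
    · refine pv.congr ?_
      filter_upwards [hfd] with y hy
      rw [hy]; rfl

end Vanishing

/-! ### The Maurer–Cartan equation in radial coordinates -/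

section Series

variable {R S : Type*} [Ring R] [Algebra ℝ R] [Ring S] [Algebra ℝ S]

/-- The truncation of the series `(exp a - 1) / a`. -/
noncomputable def expQuot (K : ℕ) (a : R) : R :=
  ∑ m ∈ Finset.range K, (1 / ((m + 1).factorial : ℝ)) • a ^ m

/-- A truncation of the inverse of `expQuot K a`. -/
noncomputable def expQuotInv (K : ℕ) (a : R) : R :=
  ∑ j ∈ Finset.range K, (1 - expQuot K a) ^ j

/-- The truncations are polynomials in a, so they pass from operators to matrices and on to matrices
with polynomial entries. -/
theorem map_expQuot (f : R →ₐ[ℝ] S) (K : ℕ) (a : R) : f (expQuot K a) = expQuot K (f a) := by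
  simp [expQuot]

theorem map_expQuotInv (f : R →ₐ[ℝ] S) (K : ℕ) (a : R) :
    f (expQuotInv K a) = expQuotInv K (f a) := by
  simp [expQuotInv, map_expQuot]

/-- This is the equation (aΦ)' = 1 + aΦ of the series Φ = (exp a - 1)/a, with the remainder caused
by truncation. The sum on the left is the Euler derivative of Φ. -/
theorem expQuot_euler (K : ℕ) (a : R) :
    (∑ m ∈ Finset.range K, (1 / ((m + 1).factorial : ℝ)) • ((m : ℝ) • a ^ m)) + expQuot K a
      - 1 - a * expQuot K a = -((1 / (K.factorial : ℝ)) • a ^ K) := by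
  induction K with
  | zero => simp [expQuot]
  | succ K ih =>
    simp only [expQuot, Finset.sum_range_succ, mul_add, mul_smul_comm, ← pow_succ'] at ih ⊢
    rw [eq_neg_iff_add_eq_zero] at ih ⊢
    rw [← ih]
    have hK : (K.factorial : ℝ) ≠ 0 := by positivity
    have hK' : (K + 1 : ℝ) ≠ 0 := by positivity
    simp only [Nat.factorial_succ]
    push_cast
    match_scalars <;> field_simp
    all_goals ring

/-- Geometric series for Φ = 1 - (1 - Φ). If a vanishes at the origin, so does 1 - Φ (for K > 0),
and the error is of order K. -/
theorem expQuot_mul_expQuotInv (K : ℕ) (a : R) :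
    expQuot K a * expQuotInv K a = 1 - (1 - expQuot K a) ^ K := by
  have := mul_neg_geom_sum (1 - expQuot K a) K
  rwa [sub_sub_cancel] at this

theorem expQuot_zero {K : ℕ} (hK : 0 < K) : expQuot K (0 : R) = 1 := by
  obtain ⟨K, rfl⟩ : ∃ l, K = l + 1 := ⟨K - 1, by omega⟩
  simp [expQuot, Finset.sum_range_succ']

end Series

/-! ### The radial equation and its solution to finite order -/

section Radial

universe u

variable {E : Type u} [NormedAddCommGroup E] [NormedSpace ℝ E]

theorem VanishesTo.mul {m l : ℕ} {f g : E → E →L[ℝ] E} (hf : VanishesTo m f)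
    (hg : VanishesTo l g) (cf : ContDiffAt ℝ ∞ f 0) (cg : ContDiffAt ℝ ∞ g 0) :
    VanishesTo (m + l) (fun x => f x * g x) := hf.clm_comp hg cf cg

theorem ContDiffAt.clm_pow {f : E → E →L[ℝ] E} {x : E} (cf : ContDiffAt ℝ ∞ f x) (j : ℕ) :
    ContDiffAt ℝ ∞ (fun x => f x ^ j) x := by
  induction j with
  | zero => simpa using contDiffAt_const
  | succ j ih => simp only [pow_succ]; exact ih.clm_comp cf

theorem VanishesTo.pow {f : E → E →L[ℝ] E} (hf : VanishesTo 1 f) (cf : ContDiffAt ℝ ∞ f 0)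
    (j : ℕ) : VanishesTo j (fun x => f x ^ j) := by
  induction j with
  | zero => exact vanishesTo_zero _
  | succ j ih => simp only [pow_succ]; exact ih.mul hf (ContDiffAt.clm_pow cf j) cf

theorem ContDiffAt.expQuot {f : E → E →L[ℝ] E} {x : E} (cf : ContDiffAt ℝ ∞ f x) (K : ℕ) :
    ContDiffAt ℝ ∞ (fun x => expQuot K (f x)) x :=
  ContDiffAt.sum fun j _ => contDiffAt_const.fun_smul (ContDiffAt.clm_pow cf j)

theorem ContDiffAt.expQuotInv {f : E → E →L[ℝ] E} {x : E} (cf : ContDiffAt ℝ ∞ f x) (K : ℕ) :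
    ContDiffAt ℝ ∞ (fun x => expQuotInv K (f x)) x :=
  ContDiffAt.sum fun j _ =>
    ContDiffAt.clm_pow (contDiffAt_const.sub (ContDiffAt.expQuot cf K)) j

/-- Uniqueness, to finite order, of the solution of a linear radial differential equation. -/
theorem vanishesTo_of_radial {A D : E → E →L[ℝ] E} {K : ℕ} (cA : ContDiffAt ℝ ∞ A 0)
    (cD : ContDiffAt ℝ ∞ D 0) (hA : VanishesTo 1 A)
    (h : VanishesTo K (fun x => fderiv ℝ D x x + D x - A x * D x)) : VanishesTo K D := by
  suffices key : ∀ j ≤ K, VanishesTo j D from key K le_rfl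
  intro j
  induction j with
  | zero => exact fun _ => vanishesTo_zero _
  | succ j ih =>
    intro hj
    have hD := ih (by omega)
    have cE := (contDiffAt_fderiv cD).clm_apply contDiffAt_id
    have cAD : ContDiffAt ℝ ∞ (fun x => A x * D x) 0 := cA.clm_comp cD
    have c1 : ContDiffAt ℝ ∞ (fun x => fderiv ℝ D x x + D x - A x * D x) 0 :=
      (cE.add cD).sub cAD
    have c2 : ContDiffAt ℝ ∞ (fun x => fderiv ℝ D x x - (j : ℝ) • D x) 0 :=
      cE.sub (contDiffAt_const.fun_smul cD)
    have h1 := hA.mul hD cA cD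
    rw [add_comm 1] at h1
    -- (j + 1)D = (DD(x)x + D - AD) + AD - (DD(x)x - jD), and every summand has order j + 1. No
    -- resonance occurs since j + 1 ≠ 0.
    have := (((h.mono hj).add h1 c1 cAD).sub (hD.euler cD) (c1.add cAD) c2).const_smul
      ((c1.add cAD).sub c2) (1 / (j + 1 : ℝ))
    refine this.congr (Eventually.of_forall fun x => ?_)
    have hne : (j + 1 : ℝ) ≠ 0 := by positivity
    simp only
    match_scalars <;> field_simp <;> ring

/-- Euler's relation for a homogeneous map of degree m: differentiate along the ray t ↦ tx at t = 1.
-/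
theorem fderiv_clm_pow_self (A : E →L[ℝ] E →L[ℝ] E) (m : ℕ) (x : E) :
    fderiv ℝ (fun x => A x ^ m) x x = (m : ℝ) • A x ^ m := by
  have hd : DifferentiableAt ℝ (fun x => A x ^ m) x :=
    (ContDiffAt.clm_pow A.contDiff.contDiffAt m).differentiableAt (by simp)
  have h1 : HasDerivAt (fun t : ℝ => t • x) x 1 := by
    simpa using (hasDerivAt_id (1 : ℝ)).smul_const x
  have h2 : HasDerivAt (fun t : ℝ => A (t • x) ^ m) (fderiv ℝ (fun x => A x ^ m) x x) 1 := by
    have hd' : HasFDerivAt (fun x => A x ^ m) (fderiv ℝ (fun x => A x ^ m) x) ((1 : ℝ) • x) := by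
      rw [one_smul]; exact hd.hasFDerivAt
    exact hd'.comp_hasDerivAt (1 : ℝ) h1
  have h3 : HasDerivAt (fun t : ℝ => A (t • x) ^ m) ((m : ℝ) • A x ^ m) 1 := by
    have : (fun t : ℝ => A (t • x) ^ m) = fun t => t ^ m • A x ^ m := by
      funext t; rw [map_smul, smul_pow]
    rw [this]
    simpa using (hasDerivAt_pow m (1 : ℝ)).smul_const (A x ^ m)
  exact h2.unique h3

theorem fderiv_expQuot_self (A : E →L[ℝ] E →L[ℝ] E) (K : ℕ) (x : E) :
    fderiv ℝ (fun x => expQuot K (A x)) x x =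
      ∑ m ∈ Finset.range K, (1 / ((m + 1).factorial : ℝ)) • ((m : ℝ) • A x ^ m) := by
  have hd : ∀ m, DifferentiableAt ℝ (fun x => A x ^ m) x := fun m =>
    (ContDiffAt.clm_pow A.contDiff.contDiffAt m).differentiableAt (by simp)
  have : HasFDerivAt (fun x => expQuot K (A x))
      (∑ m ∈ Finset.range K, (1 / ((m + 1).factorial : ℝ)) • fderiv ℝ (fun x => A x ^ m) x) x :=
    HasFDerivAt.fun_sum fun m _ => (hd m).hasFDerivAt.fun_const_smul _
  rw [this.fderiv]
  simp [fderiv_clm_pow_self]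

/-- In radial coordinates, a solution of the Maurer–Cartan equation is the truncated exponential
series, to finite order. -/
theorem vanishesTo_sub_expQuot {Z : E → E →L[ℝ] E} (c : E →L[ℝ] E →L[ℝ] E) {K : ℕ}
    (cZ : ContDiffAt ℝ ∞ Z 0)
    (hMC : ∀ᶠ x in 𝓝 (0 : E), ∀ u v, fderiv ℝ Z x u v - fderiv ℝ Z x v u = c (Z x u) (Z x v))
    (hrad : VanishesTo (K + 1) (fun x => Z x x - x)) :
    VanishesTo K (fun x => Z x - expQuot K (c x)) := by
  have cc : ContDiffAt ℝ ∞ (fun x => c x) (0 : E) := c.contDiff.contDiffAt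
  have cΦ := ContDiffAt.expQuot cc K
  set h : E → E := fun x => Z x x - x with hh
  have ch : ContDiffAt ℝ ∞ h 0 := (cZ.clm_apply contDiffAt_id).sub contDiffAt_id
  have cch : ContDiffAt ℝ ∞ (fun x => c (h x)) 0 := c.contDiff.contDiffAt.comp 0 ch
  have hc1 : VanishesTo 1 (fun x => c x) := vanishesTo_one (by simp)
  refine vanishesTo_of_radial cc (cZ.sub cΦ) hc1 ?_
  have h1 : VanishesTo K (fun x => c (h x) * Z x) :=
    ((hrad.clm_apply_left ch c).mul (vanishesTo_zero Z) cch cZ).mono (by omega)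
  have c1 : ContDiffAt ℝ ∞ (fun x => c (h x) * Z x) 0 := cch.clm_comp cZ
  have ck := contDiffAt_const (c := 1 / (K.factorial : ℝ)).smul (ContDiffAt.clm_pow cc K)
  have := (hrad.fderiv.add h1 (contDiffAt_fderiv ch) c1).add
    ((hc1.pow cc K).const_smul (ContDiffAt.clm_pow cc K) (1 / (K.factorial : ℝ)))
    ((contDiffAt_fderiv ch).add c1) ck
  refine this.congr ?_
  filter_upwards [hMC, ContDiffAt.eventually_differentiableAt cZ,
    ContDiffAt.eventually_differentiableAt cΦ] with x hx hd hd'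
  have e1 : fderiv ℝ (fun x => Z x - expQuot K (c x)) x x =
      fderiv ℝ Z x x - fderiv ℝ (fun x => expQuot K (c x)) x x := by
    have := (hd.hasFDerivAt.sub hd'.hasFDerivAt).fderiv
    exact DFunLike.congr_fun this x
  -- The Maurer–Cartan equation contracted with the position vector: Dh(x)v contains DZ(x)(v)(x),
  -- which is exchanged for DZ(x)(x)(v), and Z(x)x = x + h(x).
  have e2 : fderiv ℝ h x + c (h x) * Z x = fderiv ℝ Z x x + Z x - 1 - c x * Z x := by
    have hf : fderiv ℝ h x = _ :=
      ((hd.hasFDerivAt.clm_apply (hasFDerivAt_id x)).sub (hasFDerivAt_id x)).fderiv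
    ext v
    have := hx x v
    rw [sub_eq_iff_eq_add] at this
    rw [hf]
    simp [this, hh]
    abel
  have e3 := expQuot_euler K (c x)
  rw [← fderiv_expQuot_self c K x] at e3
  rw [e1, e2, ← sub_neg_eq_add, ← e3, mul_sub]
  abel

/-- With Φ and Ψ the two truncations at A, W - Ψ = W(1 - ZΨ) = W((1 - Φ)^K - (Z - Φ)Ψ). Positivity
of K ensures Φ = 1 at the origin. -/
theorem vanishesTo_sub_expQuotInv {Z W A : E → E →L[ℝ] E} {K : ℕ} (hK : 0 < K)
    (cZ : ContDiffAt ℝ ∞ Z 0) (cW : ContDiffAt ℝ ∞ W 0) (cA : ContDiffAt ℝ ∞ A 0) (hA : A 0 = 0)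
    (hWZ : ∀ᶠ x in 𝓝 (0 : E), W x * Z x = 1)
    (h : VanishesTo K (fun x => Z x - expQuot K (A x))) :
    VanishesTo K (fun x => W x - expQuotInv K (A x)) := by
  have cΦ := ContDiffAt.expQuot cA K
  have cΨ := ContDiffAt.expQuotInv cA K
  have c1 : ContDiffAt ℝ ∞ (fun x => 1 - expQuot K (A x)) 0 := contDiffAt_const.sub cΦ
  have cp := ContDiffAt.clm_pow c1 K
  have h1 : VanishesTo 1 (fun x => 1 - expQuot K (A x)) :=
    vanishesTo_one (by simp [hA, expQuot_zero hK])
  have cm : ContDiffAt ℝ ∞ (fun x => (Z x - expQuot K (A x)) * expQuotInv K (A x)) 0 :=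
    (cZ.sub cΦ).clm_comp cΨ
  have h2 := (vanishesTo_zero W).mul ((h1.pow c1 K).sub
    (h.mul (vanishesTo_zero _) (cZ.sub cΦ) cΨ) cp cm) cW (cp.sub cm)
  rw [zero_add] at h2
  refine h2.congr ?_
  filter_upwards [hWZ] with x hx
  have e1 := expQuot_mul_expQuotInv K (A x)
  have e2 : W x * (Z x * expQuotInv K (A x)) = expQuotInv K (A x) := by
    rw [← mul_assoc, hx, one_mul]
  rw [sub_mul, e1, mul_sub, mul_sub, e2, mul_sub, mul_one]
  abel

/-- The structure constants of a parallelism satisfying the Maurer–Cartan equation satisfy the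
Jacobi identity. -/
theorem jacobi_of_maurerCartan {Z : E → E →L[ℝ] E} (c : E →L[ℝ] E →L[ℝ] E) {x : E}
    (cZ : ContDiffAt ℝ ∞ Z x) (hanti : ∀ u v, c u v = -c v u)
    (hMC : ∀ᶠ x in 𝓝 x, ∀ u v, fderiv ℝ Z x u v - fderiv ℝ Z x v u = c (Z x u) (Z x v))
    (t u v : E) :
    c (c (Z x t) (Z x u)) (Z x v) + c (c (Z x u) (Z x v)) (Z x t)
      + c (c (Z x v) (Z x t)) (Z x u) = 0 := by
  have hd : DifferentiableAt ℝ Z x := cZ.differentiableAt (by simp)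
  have hd2 : DifferentiableAt ℝ (fderiv ℝ Z) x := (contDiffAt_fderiv cZ).differentiableAt (by simp)
  have hs : IsSymmSndFDerivAt ℝ Z x :=
    (cZ.of_le (show (2 : WithTop ℕ∞) ≤ ∞ from WithTop.coe_le_coe.2 le_top)).isSymmSndFDerivAt
      (by simp)
  -- The Maurer–Cartan equation differentiated in the direction t. In the cyclic sum the second
  -- derivatives cancel by symmetry.
  have key : ∀ t u v, fderiv ℝ (fderiv ℝ Z) x t u v - fderiv ℝ (fderiv ℝ Z) x t v u =
      c (fderiv ℝ Z x t u) (Z x v) + c (Z x u) (fderiv ℝ Z x t v) := by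
    intro t u v
    have hZ : ∀ u, HasFDerivAt (fun y => Z y u) _ x := fun u =>
      hd.hasFDerivAt.clm_apply (hasFDerivAt_const u x)
    have hZ2 : ∀ u v, HasFDerivAt (fun y => fderiv ℝ Z y u v) _ x := fun u v =>
      (hd2.hasFDerivAt.clm_apply (hasFDerivAt_const u x)).clm_apply (hasFDerivAt_const v x)
    have h1 := (hZ2 u v).sub (hZ2 v u)
    have h2 := c.hasFDerivAt_of_bilinear (hZ u) (hZ v)
    have h3 := h1.congr_of_eventuallyEq (f₁ := fun y => c (Z y u) (Z y v))
      (hMC.mono fun y hy => (hy u v).symm)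
    have := DFunLike.congr_fun (h3.unique h2) t
    simpa [add_comm] using this
  have m := hMC.self_of_nhds
  have k1 := key t u v
  have k2 := key u v t
  have k3 := key v t u
  rw [hs.eq t u, hanti (Z x u) _] at k1
  rw [hs.eq u v, hanti (Z x v) _] at k2
  rw [hs.eq v t, hanti (Z x t) _] at k3
  rw [← m t u, ← m u v, ← m v t]
  simp only [map_sub, sub_apply]
  have := congrArg₂ (· + ·) (congrArg₂ (· + ·) k1 k2) k3
  rw [← sub_eq_zero] at this
  rw [← neg_eq_zero, ← this]
  abel

end Radial

/-! ### The standard basis of the model space -/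

section StdBasis

variable {n : ℕ}

theorem stdVec_apply (j i : Fin n) : (stdVec j : Euc n) i = if i = j then 1 else 0 := by
  simp [stdVec]

theorem sum_smul_stdVec (v : Euc n) : ∑ a, v a • stdVec a = v := by
  ext i; simp [stdVec_apply]

theorem clm_ext_stdVec {F : Type*} [AddCommGroup F] [Module ℝ F] [TopologicalSpace F]
    {f g : Euc n →L[ℝ] F} (h : ∀ j, f (stdVec j) = g (stdVec j)) : f = g := by
  ext1 v
  rw [← sum_smul_stdVec v]
  simp [h]

end StdBasis

/-! ### The frame and the coframe of a parallelism in a chart -/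

section Charts

variable {n : ℕ} {M : Type*} [TopologicalSpace M] [ChartedSpace (Euc n) M]

/-- The derivative of a chart, as an endomorphism of the model space. -/
noncomputable def chartDeriv (e : OpenPartialHomeomorph M (Euc n)) (p : M) : Euc n →L[ℝ] Euc n :=
  (mfderiv (𝓡 n) (𝓡 n) e p : TangentSpace (𝓡 n) p →L[ℝ] TangentSpace (𝓡 n) (e p))

/-- The derivative of the inverse of a chart, as an endomorphism of the model space. -/
noncomputable def symmDeriv (e : OpenPartialHomeomorph M (Euc n)) (x : Euc n) :
    Euc n →L[ℝ] Euc n :=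
  (mfderiv (𝓡 n) (𝓡 n) e.symm x : TangentSpace (𝓡 n) x →L[ℝ] TangentSpace (𝓡 n) (e.symm x))

theorem mdifferentiable_of_mem {e : OpenPartialHomeomorph M (Euc n)}
    (he : e ∈ IsManifold.maximalAtlas (𝓡 n) ∞ M) : e.MDifferentiable (𝓡 n) (𝓡 n) :=
  ⟨(contMDiffOn_of_mem_maximalAtlas he).mdifferentiableOn (by simp),
    (contMDiffOn_symm_of_mem_maximalAtlas he).mdifferentiableOn (by simp)⟩

theorem chartDeriv_symmDeriv {e : OpenPartialHomeomorph M (Euc n)}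
    (he : e ∈ IsManifold.maximalAtlas (𝓡 n) ∞ M) {x : Euc n} (hx : x ∈ e.target) :
    chartDeriv e (e.symm x) * symmDeriv e x = 1 :=
  (mdifferentiable_of_mem he).comp_symm_deriv hx

theorem symmDeriv_chartDeriv {e : OpenPartialHomeomorph M (Euc n)}
    (he : e ∈ IsManifold.maximalAtlas (𝓡 n) ∞ M) {x : Euc n} (hx : x ∈ e.target) :
    symmDeriv e x * chartDeriv e (e.symm x) = 1 := by
  have := (mdifferentiable_of_mem he).symm_comp_deriv (e.map_target hx)
  rw [e.right_inv hx] at this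
  exact this

theorem contDiffAt_transition {e e' : OpenPartialHomeomorph M (Euc n)}
    (he : e ∈ IsManifold.maximalAtlas (𝓡 n) ∞ M) (he' : e' ∈ IsManifold.maximalAtlas (𝓡 n) ∞ M)
    {x : Euc n} (hx : x ∈ e.target) (hx' : e.symm x ∈ e'.source) :
    ContDiffAt ℝ ∞ (fun y => e' (e.symm y)) x := by
  have h := (IsManifold.compatible_of_mem_maximalAtlas he he').1
  have h' : ContDiffOn ℝ ∞ (fun y => e' (e.symm y)) (e.symm.trans e').source := by
    simpa [contDiffPregroupoid, Function.comp_def] using h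
  exact h'.contDiffAt ((e.symm.trans e').open_source.mem_nhds (by simp [hx, hx']))

theorem symmDeriv_transition {e e' : OpenPartialHomeomorph M (Euc n)}
    (he : e ∈ IsManifold.maximalAtlas (𝓡 n) ∞ M) (he' : e' ∈ IsManifold.maximalAtlas (𝓡 n) ∞ M)
    {x : Euc n} (hx : x ∈ e.target) (hx' : e.symm x ∈ e'.source) :
    symmDeriv e x = symmDeriv e' (e' (e.symm x)) * fderiv ℝ (fun y => e' (e.symm y)) x := by
  have hτ := ((contDiffAt_transition he he' hx hx').differentiableAt (by simp)).hasFDerivAt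
  have h1 : HasMFDerivAt (𝓡 n) (𝓡 n) e'.symm (e' (e.symm x)) _ :=
    ((mdifferentiable_of_mem he').mdifferentiableAt_symm (e'.map_source hx')).hasMFDerivAt
  have h2 := HasMFDerivAt.comp (f := fun y => e' (e.symm y)) x h1 hτ.hasMFDerivAt
  have h3 : e.symm =ᶠ[𝓝 x] e'.symm ∘ fun y => e' (e.symm y) := by
    filter_upwards [(e.symm.trans e').open_source.mem_nhds
      (show x ∈ (e.symm.trans e').source by simp [hx, hx'])] with y hy
    simp only [OpenPartialHomeomorph.trans_source, OpenPartialHomeomorph.symm_source,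
      Set.mem_inter_iff, Set.mem_preimage] at hy
    exact (e'.left_inv hy.2).symm
  exact (h2.congr_of_eventuallyEq h3).mfderiv

namespace Parallelism

variable (w : Parallelism n M) (e : OpenPartialHomeomorph M (Euc n))

/-- `w(p)` as an endomorphism of the model space. -/
noncomputable def wL (p : M) : Euc n →L[ℝ] Euc n :=
  LinearMap.toContinuousLinearMap (show Euc n →ₗ[ℝ] Euc n from (w.w p).toLinearMap)

/-- `z(p)` as an endomorphism of the model space. -/
noncomputable def zL (p : M) : Euc n →L[ℝ] Euc n :=
  LinearMap.toContinuousLinearMap (show Euc n →ₗ[ℝ] Euc n from (w.z p).toLinearMap)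

theorem wL_mul_zL (p : M) : w.wL p * w.zL p = 1 := by
  ext1 v; exact (w.w p).apply_symm_apply v

theorem zL_mul_wL (p : M) : w.zL p * w.wL p = 1 := by
  ext1 v; exact (w.w p).symm_apply_apply v

/-- The matrix of the frame in a chart. -/
noncomputable def frame (x : Euc n) : Euc n →L[ℝ] Euc n := chartDeriv e (e.symm x) * w.wL (e.symm x)

/-- The matrix of the coframe in a chart. -/
noncomputable def coframe (x : Euc n) : Euc n →L[ℝ] Euc n := w.zL (e.symm x) * symmDeriv e x

theorem wC_eq (i a : Fin n) (x : Euc n) : w.wC e i a x = w.frame e x (stdVec a) i := rfl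

theorem zC_eq (a j : Fin n) (x : Euc n) : w.zC e a j x = w.coframe e x (stdVec j) a := rfl

variable {e} (he : e ∈ IsManifold.maximalAtlas (𝓡 n) ∞ M)
include he

theorem frame_mul_coframe {x : Euc n} (hx : x ∈ e.target) : w.frame e x * w.coframe e x = 1 := by
  rw [frame, coframe, mul_assoc, ← mul_assoc (w.wL _), wL_mul_zL, one_mul,
    chartDeriv_symmDeriv he hx]

theorem coframe_mul_frame {x : Euc n} (hx : x ∈ e.target) : w.coframe e x * w.frame e x = 1 := by
  rw [frame, coframe, mul_assoc, ← mul_assoc (symmDeriv _ _), symmDeriv_chartDeriv he hx, one_mul,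
    zL_mul_wL]

/-- The coframe is a vector-valued one-form, so a change of chart pulls it back. -/
theorem coframe_transition {e' : OpenPartialHomeomorph M (Euc n)}
    (he' : e' ∈ IsManifold.maximalAtlas (𝓡 n) ∞ M)
    {x : Euc n} (hx : x ∈ e.target) (hx' : e.symm x ∈ e'.source) :
    w.coframe e x =
      w.coframe e' (e' (e.symm x)) * fderiv ℝ (fun y => e' (e.symm y)) x := by
  rw [coframe, coframe, symmDeriv_transition he he' hx hx', e'.left_inv hx', mul_assoc]

theorem contDiffAt_frame {x : Euc n} (hx : x ∈ e.target) : ContDiffAt ℝ ∞ (w.frame e) x := by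
  have h : ContDiffAt ℝ ∞ (fun y => ∑ a, ∑ i, w.wC e i a y •
      (EuclideanSpace.proj a : Euc n →L[ℝ] ℝ).smulRight (stdVec i)) x :=
    ContDiffAt.sum fun a _ => ContDiffAt.sum fun i _ =>
      ((w.smooth e he i a).contDiffAt (e.open_target.mem_nhds hx)).smul contDiffAt_const
  convert h using 1
  funext y
  refine ContinuousLinearMap.ext fun v => ?_
  conv_lhs => rw [← sum_smul_stdVec v]
  rw [map_sum, sum_apply]
  refine Finset.sum_congr rfl fun a _ => ?_
  ext i
  simp [wC_eq, stdVec_apply, mul_comm]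

/-- Inversion is smooth at the units of the Banach algebra of endomorphisms. -/
theorem contDiffAt_coframe {x : Euc n} (hx : x ∈ e.target) : ContDiffAt ℝ ∞ (w.coframe e) x := by
  let W : (Euc n →L[ℝ] Euc n)ˣ :=
    ⟨w.frame e x, w.coframe e x, w.frame_mul_coframe he hx, w.coframe_mul_frame he hx⟩
  have h : ContDiffAt ℝ ∞ (fun y => Ring.inverse (w.frame e y)) x :=
    ContDiffAt.comp (g := Ring.inverse) x (contDiffAt_ringInverse ℝ W) (w.contDiffAt_frame he hx)
  refine h.congr_of_eventuallyEq ?_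
  filter_upwards [e.open_target.mem_nhds hx] with y hy
  exact (Ring.inverse_unit (⟨w.frame e y, w.coframe e y, w.frame_mul_coframe he hy,
    w.coframe_mul_frame he hy⟩ : (Euc n →L[ℝ] Euc n)ˣ)).symm

end Parallelism

end Charts

/-! ### The structure constants of a local Lie group -/

section PartialDeriv

variable {n : ℕ} {f g : Euc n → ℝ} {x : Euc n}

theorem partialDeriv_mul (r : Fin n) (hf : DifferentiableAt ℝ f x) (hg : DifferentiableAt ℝ g x) :
    partialDeriv r (fun y => f y * g y) x = partialDeriv r f x * g x + f x * partialDeriv r g x := by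
  rw [partialDeriv, fderiv_fun_mul hf hg]
  simp [partialDeriv]
  ring

theorem partialDeriv_sum {ι : Type*} (s : Finset ι) {f : ι → Euc n → ℝ} (r : Fin n)
    (hf : ∀ i ∈ s, DifferentiableAt ℝ (f i) x) :
    partialDeriv r (fun y => ∑ i ∈ s, f i y) x = ∑ i ∈ s, partialDeriv r (f i) x := by
  rw [partialDeriv, fderiv_fun_sum hf]
  simp [partialDeriv]

/-- The derivative of a `(1, 2)`-tensor in a frame is the covariant derivative in this frame. -/
theorem sum_frame_derivative (z w G dz dw : Fin n → Fin n → ℝ) (T dT : Fin n → Fin n → Fin n → ℝ)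
    (hz : ∀ i a, dz i a = -∑ d, z i d * G d a) (hw : ∀ b j, dw b j = ∑ d, G b d * w d j)
    (i j k : Fin n) :
    ∑ a, ∑ b, ∑ c, (((dz i a * T a b c + z i a * dT a b c) * w b j + z i a * T a b c * dw b j) *
      w c k + z i a * T a b c * w b j * dw c k) =
    ∑ a, ∑ b, ∑ c, z i a * (dT a b c - ∑ d, G a d * T d b c + ∑ d, G d b * T a d c
      + ∑ d, G d c * T a b d) * w b j * w c k := by
  have e1 : ∀ b c, ∑ a, dz i a * T a b c = -∑ a, z i a * ∑ d, G a d * T d b c := fun b c => by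
    simp only [hz, neg_mul, Finset.sum_neg_distrib, Finset.sum_mul, Finset.mul_sum]
    rw [Finset.sum_comm]
    simp only [mul_assoc]
  have e2 : ∀ a c, ∑ b, T a b c * dw b j = ∑ b, (∑ d, G d b * T a d c) * w b j := fun a c => by
    simp only [hw, Finset.sum_mul, Finset.mul_sum]
    rw [Finset.sum_comm]
    exact Finset.sum_congr rfl fun b _ => Finset.sum_congr rfl fun d _ => by ring
  have e3 : ∀ a b, ∑ c, T a b c * dw c k = ∑ c, (∑ d, G d c * T a b d) * w c k := fun a b => by
    simp only [hw, Finset.sum_mul, Finset.mul_sum]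
    rw [Finset.sum_comm]
    exact Finset.sum_congr rfl fun b _ => Finset.sum_congr rfl fun d _ => by ring
  have t1 : ∑ a, ∑ b, ∑ c, dz i a * T a b c * w b j * w c k =
      -∑ a, ∑ b, ∑ c, z i a * (∑ d, G a d * T d b c) * w b j * w c k := by
    have (f : Fin n → Fin n → Fin n → ℝ) :
        ∑ a, ∑ b, ∑ c, f a b c * w b j * w c k = ∑ b, ∑ c, (∑ a, f a b c) * w b j * w c k := by
      rw [Finset.sum_comm]
      refine Finset.sum_congr rfl fun b _ => ?_
      rw [Finset.sum_comm]
      simp only [Finset.sum_mul]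
    rw [this, this fun a b c => z i a * ∑ d, G a d * T d b c]
    simp only [e1, neg_mul, Finset.sum_neg_distrib]
  have t2 : ∑ a, ∑ b, ∑ c, z i a * T a b c * dw b j * w c k =
      ∑ a, ∑ b, ∑ c, z i a * (∑ d, G d b * T a d c) * w b j * w c k := by
    have (f : Fin n → Fin n → Fin n → ℝ) :
        ∑ a, ∑ b, ∑ c, z i a * f a b c * w c k = ∑ a, ∑ c, z i a * (∑ b, f a b c) * w c k := by
      refine Finset.sum_congr rfl fun b _ => ?_
      rw [Finset.sum_comm]
      simp only [Finset.sum_mul, Finset.mul_sum]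
    have h1 := this fun a b c => T a b c * dw b j
    have h2 := this fun a b c => (∑ d, G d b * T a d c) * w b j
    simp only [e2] at h1
    simp only [← mul_assoc (z i _)] at h1 h2
    exact h1.trans h2.symm
  have t3 : ∑ a, ∑ b, ∑ c, z i a * T a b c * w b j * dw c k =
      ∑ a, ∑ b, ∑ c, z i a * (∑ d, G d c * T a b d) * w b j * w c k := by
    refine Finset.sum_congr rfl fun a _ => Finset.sum_congr rfl fun b _ => ?_
    have := congrArg (fun s => z i a * w b j * s) (e3 a b)
    rw [Finset.mul_sum, Finset.mul_sum] at this
    refine Eq.trans ?_ (this.trans ?_) <;> exact Finset.sum_congr rfl fun c _ => by ring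
  simp only [add_mul, mul_add, mul_sub, sub_mul, Finset.sum_add_distrib, Finset.sum_sub_distrib,
    t1, t2, t3]
  ring

end PartialDeriv

namespace Parallelism

variable {n : ℕ} {M : Type*} [TopologicalSpace M] [ChartedSpace (Euc n) M]
  (w : Parallelism n M) {e : OpenPartialHomeomorph M (Euc n)}
  (he : e ∈ IsManifold.maximalAtlas (𝓡 n) ∞ M)

section
include he

theorem differentiableAt_frame {x : Euc n} (hx : x ∈ e.target) :
    DifferentiableAt ℝ (w.frame e) x := (w.contDiffAt_frame he hx).differentiableAt (by simp)

theorem differentiableAt_coframe {x : Euc n} (hx : x ∈ e.target) :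
    DifferentiableAt ℝ (w.coframe e) x := (w.contDiffAt_coframe he hx).differentiableAt (by simp)

theorem contDiffAt_wC {x : Euc n} (hx : x ∈ e.target) (i a : Fin n) :
    ContDiffAt ℝ ∞ (w.wC e i a) x :=
  (w.smooth e he i a).contDiffAt (e.open_target.mem_nhds hx)

theorem contDiffAt_zC {x : Euc n} (hx : x ∈ e.target) (a j : Fin n) :
    ContDiffAt ℝ ∞ (w.zC e a j) x :=
  (EuclideanSpace.proj a : Euc n →L[ℝ] ℝ).contDiff.contDiffAt.comp x
    ((w.contDiffAt_coframe he hx).clm_apply contDiffAt_const)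

theorem partialDeriv_wC {x : Euc n} (hx : x ∈ e.target) (r i a : Fin n) :
    partialDeriv r (w.wC e i a) x = fderiv ℝ (w.frame e) x (stdVec r) (stdVec a) i := by
  have h := (EuclideanSpace.proj i : Euc n →L[ℝ] ℝ).hasFDerivAt.comp x
    ((w.differentiableAt_frame he hx).hasFDerivAt.clm_apply (hasFDerivAt_const (stdVec a) x))
  have h' : fderiv ℝ (w.wC e i a) x = _ := h.fderiv
  rw [partialDeriv, h']
  simp

theorem contDiffAt_Gam {x : Euc n} (hx : x ∈ e.target) (i j k : Fin n) :
    ContDiffAt ℝ ∞ (w.Gam e i j k) x :=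
  ContDiffAt.sum fun a _ => (w.contDiffAt_zC he hx a j).mul
    ((contDiffAt_fderiv (w.contDiffAt_wC he hx i a)).clm_apply contDiffAt_const)

theorem contDiffAt_T {x : Euc n} (hx : x ∈ e.target) (i j k : Fin n) :
    ContDiffAt ℝ ∞ (w.T e i j k) x :=
  (w.contDiffAt_Gam he hx i j k).sub (w.contDiffAt_Gam he hx i k j)

theorem sum_zC_mul_wC {x : Euc n} (hx : x ∈ e.target) (a b : Fin n) :
    ∑ i, w.zC e a i x * w.wC e i b x = if a = b then 1 else 0 := by
  have h := w.coframe_mul_frame he hx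
  have h2 : w.coframe e x (w.frame e x (stdVec b)) = stdVec b := DFunLike.congr_fun h (stdVec b)
  rw [← sum_smul_stdVec (w.frame e x (stdVec b)), map_sum] at h2
  have := congrArg (fun v : Euc n => v a) h2
  simpa [stdVec_apply, wC_eq, zC_eq, mul_comm] using this

theorem sum_wC_mul_zC {x : Euc n} (hx : x ∈ e.target) (i j : Fin n) :
    ∑ a, w.wC e i a x * w.zC e a j x = if i = j then 1 else 0 := by
  have h := w.frame_mul_coframe he hx
  have h2 : w.frame e x (w.coframe e x (stdVec j)) = stdVec j := DFunLike.congr_fun h (stdVec j)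
  rw [← sum_smul_stdVec (w.coframe e x (stdVec j)), map_sum] at h2
  have := congrArg (fun v : Euc n => v i) h2
  simpa [stdVec_apply, wC_eq, zC_eq, mul_comm] using this

/-- The frame is parallel: multiply the definition of Γ by w and use zw = 1. -/
theorem partialDeriv_wC_eq_sum {x : Euc n} (hx : x ∈ e.target) (r i a : Fin n) :
    partialDeriv r (w.wC e i a) x = ∑ j, w.Gam e i j r x * w.wC e j a x := by
  simp only [Gam, Finset.sum_mul]
  rw [Finset.sum_comm]
  have : ∀ b, ∑ j, w.zC e b j x * partialDeriv r (w.wC e i b) x * w.wC e j a x =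
      partialDeriv r (w.wC e i b) x * if b = a then 1 else 0 := fun b => by
    rw [← w.sum_zC_mul_wC he hx, Finset.mul_sum]
    exact Finset.sum_congr rfl fun j _ => by ring
  simp [this]

/-- The coframe is parallel: differentiate zw = 1 and multiply by z on the right. -/
theorem partialDeriv_zC_eq_sum {x : Euc n} (hx : x ∈ e.target) (r a j : Fin n) :
    partialDeriv r (w.zC e a j) x = -∑ i, w.zC e a i x * w.Gam e i j r x := by
  have dz := fun i => (w.contDiffAt_zC he hx a i).differentiableAt (by simp)
  have dw := fun i b => (w.contDiffAt_wC he hx i b).differentiableAt (by simp)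
  have h0 : ∀ b, ∑ i, (partialDeriv r (w.zC e a i) x * w.wC e i b x +
      w.zC e a i x * partialDeriv r (w.wC e i b) x) = 0 := by
    intro b
    have h1 : (fun y => ∑ i, w.zC e a i y * w.wC e i b y) =ᶠ[𝓝 x]
        fun _ => if a = b then 1 else 0 := by
      filter_upwards [e.open_target.mem_nhds hx] with y hy using w.sum_zC_mul_wC he hy a b
    have h2 : partialDeriv r (fun y => ∑ i, w.zC e a i y * w.wC e i b y) x = 0 := by
      rw [partialDeriv, h1.fderiv_eq]; simp
    rw [partialDeriv_sum _ _ fun i _ => (dz i).fun_mul (dw i b)] at h2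
    rw [← h2]
    exact Finset.sum_congr rfl fun i _ => (partialDeriv_mul r (dz i) (dw i b)).symm
  have h3 : ∑ b, (∑ i, (partialDeriv r (w.zC e a i) x * w.wC e i b x +
      w.zC e a i x * partialDeriv r (w.wC e i b) x)) * w.zC e b j x = 0 := by
    simp [h0]
  simp only [Finset.sum_add_distrib, add_mul, Finset.sum_mul] at h3
  rw [Finset.sum_comm, Finset.sum_comm (f := fun b i => w.zC e a i x * _ * _)] at h3
  have h4 : ∀ i, ∑ b, partialDeriv r (w.zC e a i) x * w.wC e i b x * w.zC e b j x =
      partialDeriv r (w.zC e a i) x * if i = j then 1 else 0 := fun i => by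
    rw [← w.sum_wC_mul_zC he hx, Finset.mul_sum]
    exact Finset.sum_congr rfl fun b _ => by ring
  have h5 : ∀ i, ∑ b, w.zC e a i x * partialDeriv r (w.wC e i b) x * w.zC e b j x =
      w.zC e a i x * w.Gam e i j r x := fun i => by
    rw [Gam, Finset.mul_sum]
    exact Finset.sum_congr rfl fun b _ => by ring
  simp only [h4, h5] at h3
  simp only [mul_ite, mul_one, mul_zero, Finset.sum_ite_eq', Finset.mem_univ, if_true] at h3
  exact eq_neg_of_add_eq_zero_left h3

theorem contDiffAt_frameT {x : Euc n} (hx : x ∈ e.target) (i j k : Fin n) :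
    ContDiffAt ℝ ∞ (w.frameT e i j k) x :=
  ContDiffAt.sum fun a _ => ContDiffAt.sum fun b _ => ContDiffAt.sum fun c _ =>
    (((w.contDiffAt_zC he hx i a).mul (w.contDiffAt_T he hx a b c)).mul
      (w.contDiffAt_wC he hx b j)).mul (w.contDiffAt_wC he hx c k)

/-- Because the frame is parallel, plain differentiation of frame components is covariant
differentiation of the tensor. This is where the linear curvature enters. -/
theorem partialDeriv_frameT {x : Euc n} (hx : x ∈ e.target) (i j k r : Fin n) :
    partialDeriv r (w.frameT e i j k) x =
      ∑ a, ∑ b, ∑ c, w.zC e i a x * w.curv e a b c r x * w.wC e b j x * w.wC e c k x := by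
  have dz := fun i a => (w.contDiffAt_zC he hx i a).differentiableAt (by simp)
  have dw := fun i b => (w.contDiffAt_wC he hx i b).differentiableAt (by simp)
  have dT := fun a b c => (w.contDiffAt_T he hx a b c).differentiableAt (by simp)
  have d4 := fun a b c => (((dz i a).fun_mul (dT a b c)).fun_mul (dw b j)).fun_mul (dw c k)
  have d3 := fun a b => DifferentiableAt.fun_sum (u := Finset.univ) fun c _ => d4 a b c
  have d2 := fun a => DifferentiableAt.fun_sum (u := Finset.univ) fun b _ => d3 a b
  rw [show w.frameT e i j k = fun y => ∑ a, ∑ b, ∑ c,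
    w.zC e i a y * w.T e a b c y * w.wC e b j y * w.wC e c k y from rfl,
    partialDeriv_sum _ _ fun a _ => d2 a]
  simp only [curv]
  rw [← sum_frame_derivative (fun i a => w.zC e i a x) (fun b j => w.wC e b j x)
    (fun b d => w.Gam e b d r x) (fun i a => partialDeriv r (w.zC e i a) x)
    (fun b j => partialDeriv r (w.wC e b j) x) (fun a b c => w.T e a b c x)
    (fun a b c => partialDeriv r (w.T e a b c) x)
    (fun i a => w.partialDeriv_zC_eq_sum he hx r i a)
    (fun b j => w.partialDeriv_wC_eq_sum he hx r b j)]
  refine Finset.sum_congr rfl fun a _ => ?_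
  rw [partialDeriv_sum _ _ fun b _ => d3 a b]
  refine Finset.sum_congr rfl fun b _ => ?_
  rw [partialDeriv_sum _ _ fun c _ => d4 a b c]
  refine Finset.sum_congr rfl fun c _ => ?_
  rw [partialDeriv_mul r (((dz i a).fun_mul (dT a b c)).fun_mul (dw b j)) (dw c k),
    partialDeriv_mul r ((dz i a).fun_mul (dT a b c)) (dw b j),
    partialDeriv_mul r (dz i a) (dT a b c)]

theorem fderiv_frameT_eq_zero (hw : w.IsLocalLieGroup) {x : Euc n} (hx : x ∈ e.target)
    (i j k : Fin n) : fderiv ℝ (w.frameT e i j k) x = 0 := by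
  refine clm_ext_stdVec fun r => ?_
  have := w.partialDeriv_frameT he hx i j k r
  simpa [hw e he x hx, partialDeriv] using this

theorem coframe_fderiv_frame {x : Euc n} (hx : x ∈ e.target) (u v : Euc n) :
    w.coframe e x (fderiv ℝ (w.frame e) x u v) =
      -fderiv ℝ (w.coframe e) x u (w.frame e x v) := by
  have h1 : (fun y => w.coframe e y (w.frame e y v)) =ᶠ[𝓝 x] fun _ => v := by
    filter_upwards [e.open_target.mem_nhds hx] with y hy
    exact DFunLike.congr_fun (w.coframe_mul_frame he hy) v
  have h2 := (w.differentiableAt_coframe he hx).hasFDerivAt.clm_apply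
    ((w.differentiableAt_frame he hx).hasFDerivAt.clm_apply (hasFDerivAt_const v x))
  have h3 := DFunLike.congr_fun (h2.fderiv.symm.trans h1.fderiv_eq) u
  rw [eq_neg_iff_add_eq_zero]
  simpa using h3

/-- The torsion in the frame is the exterior derivative of the coframe. -/
theorem frameT_eq {x : Euc n} (hx : x ∈ e.target) (i j k : Fin n) :
    w.frameT e i j k x =
      (fderiv ℝ (w.coframe e) x (w.frame e x (stdVec j)) (w.frame e x (stdVec k)) -
        fderiv ℝ (w.coframe e) x (w.frame e x (stdVec k)) (w.frame e x (stdVec j))) i := by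
  -- By parallelism of the frame, Γ contracted with two frame vectors is the derivative of one along
  -- the other.
  have hD : ∀ a j k, (fderiv ℝ (w.frame e) x (w.frame e x (stdVec k)) (stdVec j)) a =
      ∑ b, ∑ c, w.Gam e a b c x * w.wC e b j x * w.wC e c k x := by
    intro a j k
    rw [Finset.sum_comm]
    conv_lhs => rw [← sum_smul_stdVec (w.frame e x (stdVec k))]
    rw [map_sum, sum_apply, WithLp.ofLp_sum, Finset.sum_apply]
    refine Finset.sum_congr rfl fun c _ => ?_
    rw [← Finset.sum_mul, ← w.partialDeriv_wC_eq_sum he hx, w.partialDeriv_wC he hx]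
    simp [wC_eq, mul_comm]
  have h2 : w.frameT e i j k x = (w.coframe e x (fderiv ℝ (w.frame e) x (w.frame e x (stdVec k))
      (stdVec j) - fderiv ℝ (w.frame e) x (w.frame e x (stdVec j)) (stdVec k))) i := by
    rw [← sum_smul_stdVec (fderiv ℝ (w.frame e) x (w.frame e x (stdVec k))
      (stdVec j) - fderiv ℝ (w.frame e) x (w.frame e x (stdVec j)) (stdVec k)), map_sum,
      WithLp.ofLp_sum, Finset.sum_apply, frameT]
    refine Finset.sum_congr rfl fun a _ => ?_
    rw [PiLp.sub_apply, hD, hD, Finset.sum_comm (f := fun b c => w.Gam e a b c x * w.wC e b k x * _),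
      ← Finset.sum_sub_distrib, map_smul, PiLp.smul_apply, ← zC_eq, smul_eq_mul, Finset.sum_mul]
    refine Finset.sum_congr rfl fun b _ => ?_
    rw [← Finset.sum_sub_distrib, Finset.sum_mul]
    refine Finset.sum_congr rfl fun c _ => ?_
    rw [T]
    ring
  rw [h2, map_sub, w.coframe_fderiv_frame he hx, w.coframe_fderiv_frame he hx, neg_sub_neg]

theorem fderiv_transition_frame {e' : OpenPartialHomeomorph M (Euc n)}
    (he' : e' ∈ IsManifold.maximalAtlas (𝓡 n) ∞ M)
    {x : Euc n} (hx : x ∈ e.target) (hx' : e.symm x ∈ e'.source) (v : Euc n) :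
    fderiv ℝ (fun y => e' (e.symm y)) x (w.frame e x v) = w.frame e' (e' (e.symm x)) v := by
  have h1 := w.frame_mul_coframe he' (e'.map_source hx')
  have h2 := w.coframe_mul_frame he hx
  rw [w.coframe_transition he he' hx hx'] at h2
  have h3 : fderiv ℝ (fun y => e' (e.symm y)) x * w.frame e x = w.frame e' (e' (e.symm x)) := by
    rw [← mul_one (w.frame e' _), ← h2, mul_assoc (w.coframe e' _), ← mul_assoc, h1, one_mul]
  exact DFunLike.congr_fun h3 v

/-- Naturality of the exterior derivative: the second derivative of the transition map is symmetric
and drops out. -/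
theorem fderiv_coframe_transition {e' : OpenPartialHomeomorph M (Euc n)}
    (he' : e' ∈ IsManifold.maximalAtlas (𝓡 n) ∞ M)
    {x : Euc n} (hx : x ∈ e.target) (hx' : e.symm x ∈ e'.source) (u v : Euc n) :
    fderiv ℝ (w.coframe e) x u v - fderiv ℝ (w.coframe e) x v u =
      fderiv ℝ (w.coframe e') (e' (e.symm x)) (fderiv ℝ (fun y => e' (e.symm y)) x u)
        (fderiv ℝ (fun y => e' (e.symm y)) x v) -
      fderiv ℝ (w.coframe e') (e' (e.symm x)) (fderiv ℝ (fun y => e' (e.symm y)) x v)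
        (fderiv ℝ (fun y => e' (e.symm y)) x u) := by
  have cτ := contDiffAt_transition he he' hx hx'
  set τ : Euc n → Euc n := fun y => e' (e.symm y) with hτ
  have h1 : w.coframe e =ᶠ[𝓝 x] fun y => (w.coframe e' (τ y)).comp (fderiv ℝ τ y) := by
    filter_upwards [(e.symm.trans e').open_source.mem_nhds
      (show x ∈ (e.symm.trans e').source by simp [hx, hx'])] with y hy
    simp only [OpenPartialHomeomorph.trans_source, OpenPartialHomeomorph.symm_source,
      Set.mem_inter_iff, Set.mem_preimage] at hy
    exact w.coframe_transition he he' hy.1 hy.2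
  have hs : IsSymmSndFDerivAt ℝ τ x :=
    (cτ.of_le (show (2 : WithTop ℕ∞) ≤ ∞ from WithTop.coe_le_coe.2 le_top)).isSymmSndFDerivAt
      (by simp)
  have h2 := (((w.differentiableAt_coframe he' (e'.map_source hx')).hasFDerivAt.comp x
    (cτ.differentiableAt (by simp)).hasFDerivAt).clm_comp
      ((contDiffAt_fderiv cτ).differentiableAt (by simp)).hasFDerivAt).fderiv
  have h3 := h1.fderiv_eq.trans h2
  rw [h3]
  simp [hs.eq u v]

theorem frameT_transition {e' : OpenPartialHomeomorph M (Euc n)}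
    (he' : e' ∈ IsManifold.maximalAtlas (𝓡 n) ∞ M)
    {x : Euc n} (hx : x ∈ e.target) (hx' : e.symm x ∈ e'.source) (i j k : Fin n) :
    w.frameT e i j k x = w.frameT e' i j k (e' (e.symm x)) := by
  rw [w.frameT_eq he hx, w.frameT_eq he' (e'.map_source hx'),
    w.fderiv_coframe_transition he he' hx hx']
  simp only [w.fderiv_transition_frame he he' hx hx']

end

/-- The value at p is read in the preferred chart at p. Chart independence allows one fixed chart to
be used near p, where the derivative vanishes; connectedness does the rest. -/
theorem exists_hasLieConstants [IsManifold (𝓡 n) ∞ M] [ConnectedSpace M]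
    (hw : w.IsLocalLieGroup) : ∃ C, w.HasLieConstants C := by
  have key : ∀ i j k, ∃ c : ℝ, ∀ p : M, w.frameT (chartAt (Euc n) p) i j k (chartAt (Euc n) p p) = c := by
    intro i j k
    obtain ⟨p₀⟩ : Nonempty M := inferInstance
    refine ⟨_, fun p => IsLocallyConstant.apply_eq_of_preconnectedSpace
      (f := fun p => w.frameT (chartAt (Euc n) p) i j k (chartAt (Euc n) p p)) ?_ p p₀⟩
    rw [IsLocallyConstant.iff_eventually_eq]
    intro p
    have he := IsManifold.chart_mem_maximalAtlas (I := 𝓡 n) (n := ∞) p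
    set e := chartAt (Euc n) p
    have hp : p ∈ e.source := mem_chart_source _ p
    obtain ⟨ε, hε, hb⟩ := Metric.isOpen_iff.1 e.open_target _ (e.map_source hp)
    filter_upwards [e.open_source.mem_nhds hp, (e.continuousAt hp).eventually
      (Metric.ball_mem_nhds (e p) hε)] with q hq hqb
    have h1 := w.frameT_transition (IsManifold.chart_mem_maximalAtlas (I := 𝓡 n) (n := ∞) q) he
      (mem_chart_target _ q)
      (by rw [(chartAt (Euc n) q).left_inv (mem_chart_source _ q)]; exact hq) i j k
    rw [(chartAt (Euc n) q).left_inv (mem_chart_source _ q)] at h1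
    rw [h1]
    refine Metric.isOpen_ball.is_const_of_fderiv_eq_zero (𝕜 := ℝ)
      (convex_ball (e p) ε).isPreconnected (fun y hy => ?_) (fun y hy => ?_) hqb
      (Metric.mem_ball_self hε)
    · exact ((w.contDiffAt_frameT he (hb hy) i j k).differentiableAt (by simp)).differentiableWithinAt
    · exact w.fderiv_frameT_eq_zero he hw (hb hy) i j k
  choose C hC using key
  refine ⟨C, fun e he x hx i j k => ?_⟩
  have := w.frameT_transition he (IsManifold.chart_mem_maximalAtlas (I := 𝓡 n) (n := ∞) (e.symm x))
    hx (mem_chart_source _ _) i j k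
  rw [this, hC]

end Parallelism

/-! ### The Lie algebra of a local Lie group, and radial charts -/

section Bracket

variable {n : ℕ}

/-- The bilinear map with the components `C^i_{jk}`. -/
noncomputable def bracket (C : Fin n → Fin n → Fin n → ℝ) : Euc n →L[ℝ] Euc n →L[ℝ] Euc n :=
  ∑ i, ∑ a, ∑ b, C i a b • (EuclideanSpace.proj a : Euc n →L[ℝ] ℝ).smulRight
    ((EuclideanSpace.proj b : Euc n →L[ℝ] ℝ).smulRight (stdVec i))

theorem bracket_apply (C : Fin n → Fin n → Fin n → ℝ) (u v : Euc n) (i : Fin n) :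
    bracket C u v i = ∑ a, ∑ b, C i a b * (u a * v b) := by
  simp [bracket, stdVec_apply, sum_apply]

theorem bracket_stdVec (C : Fin n → Fin n → Fin n → ℝ) (j k i : Fin n) :
    bracket C (stdVec j) (stdVec k) i = C i j k := by
  simp [bracket_apply, stdVec_apply]

theorem bracket_antisymm {C : Fin n → Fin n → Fin n → ℝ} (hC : ∀ i j k, C i j k = -C i k j)
    (u v : Euc n) : bracket C u v = -bracket C v u := by
  ext i
  rw [PiLp.neg_apply, bracket_apply, bracket_apply, Finset.sum_comm, ← Finset.sum_neg_distrib]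
  refine Finset.sum_congr rfl fun b _ => ?_
  rw [← Finset.sum_neg_distrib]
  refine Finset.sum_congr rfl fun a _ => ?_
  rw [hC i a b]
  ring

theorem isLieAlgebra_of_jacobi {C : Fin n → Fin n → Fin n → ℝ} (hC : ∀ i j k, C i j k = -C i k j)
    (h : ∀ t u v, bracket C (bracket C t u) v + bracket C (bracket C u v) t
      + bracket C (bracket C v t) u = 0) : IsLieAlgebra C := by
  refine ⟨hC, fun i j k l => ?_⟩
  have h1 : ∀ j k l, bracket C (bracket C (stdVec j) (stdVec k)) (stdVec l) i =
      ∑ m, C m j k * C i m l := by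
    intro j k l
    rw [bracket_apply]
    refine Finset.sum_congr rfl fun m _ => ?_
    simp [bracket_stdVec, stdVec_apply, mul_comm]
  have := congrArg (fun v : Euc n => v i) (h (stdVec j) (stdVec k) (stdVec l))
  simpa [h1, Finset.sum_add_distrib] using this

end Bracket

section Radial

variable {n : ℕ} {M : Type*} [TopologicalSpace M] [ChartedSpace (Euc n) M]

namespace Parallelism

variable (w : Parallelism n M) {C : Fin n → Fin n → Fin n → ℝ} (hC : w.HasLieConstants C)
include hC

theorem lieConstants_antisymm [IsManifold (𝓡 n) ∞ M] [Nonempty M] (i j k : Fin n) :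
    C i j k = -C i k j := by
  obtain ⟨p⟩ : Nonempty M := inferInstance
  have he := IsManifold.chart_mem_maximalAtlas (I := 𝓡 n) (n := ∞) p
  have hx := mem_chart_target (Euc n) p
  rw [← hC _ he _ hx, ← hC _ he _ hx i k j, w.frameT_eq he hx, w.frameT_eq he hx, ← PiLp.neg_apply,
    neg_sub]

/-- The Maurer–Cartan equation. -/
theorem maurerCartan {e : OpenPartialHomeomorph M (Euc n)}
    (he : e ∈ IsManifold.maximalAtlas (𝓡 n) ∞ M) {x : Euc n} (hx : x ∈ e.target) (u v : Euc n) :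
    fderiv ℝ (w.coframe e) x u v - fderiv ℝ (w.coframe e) x v u =
      bracket C (w.coframe e x u) (w.coframe e x v) := by
  let D := fderiv ℝ (w.coframe e) x
  let W := w.frame e x
  -- `frameT_eq` is this identity on basis vectors; evaluating at Zu, Zv and using WZ = 1 removes
  -- the frame.
  have h : (D.flip.comp W).flip.comp W - (D.comp W).flip.comp W = bracket C := by
    refine clm_ext_stdVec fun j => clm_ext_stdVec fun k => ?_
    ext i
    have := w.frameT_eq he hx i j k
    rw [bracket_stdVec, ← hC e he x hx, this]
    rfl
  have h1 := DFunLike.congr_fun (DFunLike.congr_fun h (w.coframe e x u)) (w.coframe e x v)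
  have h2 : ∀ u, W (w.coframe e x u) = u := fun u => DFunLike.congr_fun (w.frame_mul_coframe he hx) u
  simpa [h2, D] using h1

theorem isLieAlgebra [IsManifold (𝓡 n) ∞ M] [Nonempty M] : IsLieAlgebra C := by
  have ha := w.lieConstants_antisymm hC
  refine isLieAlgebra_of_jacobi ha fun t u v => ?_
  obtain ⟨p⟩ : Nonempty M := inferInstance
  have he := IsManifold.chart_mem_maximalAtlas (I := 𝓡 n) (n := ∞) p
  have hx := mem_chart_target (Euc n) p
  set e := chartAt (Euc n) p
  have := jacobi_of_maurerCartan (bracket C) (w.contDiffAt_coframe he hx) (bracket_antisymm ha)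
    (by filter_upwards [e.open_target.mem_nhds hx] with y hy using
      w.maurerCartan hC he hy)
    (w.frame e (e p) t) (w.frame e (e p) u) (w.frame e (e p) v)
  have h2 : ∀ u, w.coframe e (e p) (w.frame e (e p) u) = u :=
    fun u => DFunLike.congr_fun (w.coframe_mul_frame he hx) u
  simpa only [h2] using this

end Parallelism

theorem trans_mem_maximalAtlas {e : OpenPartialHomeomorph M (Euc n)}
    (he : e ∈ IsManifold.maximalAtlas (𝓡 n) ∞ M) {f : OpenPartialHomeomorph (Euc n) (Euc n)}
    (hf : f ∈ contDiffGroupoid ∞ (𝓡 n)) :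
    e.trans f ∈ IsManifold.maximalAtlas (𝓡 n) ∞ M := by
  intro c hc
  obtain ⟨h1, h2⟩ := he c hc
  constructor
  · rw [OpenPartialHomeomorph.trans_symm_eq_symm_trans_symm, OpenPartialHomeomorph.trans_assoc]
    exact StructureGroupoid.trans _ (StructureGroupoid.symm _ hf) h1
  · rw [← OpenPartialHomeomorph.trans_assoc]
    exact StructureGroupoid.trans _ h2 hf

/-- Inverse function theorem. The source is cut down to an open set on which θ is smooth with
invertible derivative, so that the inverse is smooth on the whole target. -/
theorem exists_mem_contDiffGroupoid {θ : Euc n → Euc n} {x : Euc n}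
    (hθ : ∀ᶠ y in 𝓝 x, ContDiffAt ℝ ∞ θ y) (hd : IsUnit (fderiv ℝ θ x)) :
    ∃ Θ : OpenPartialHomeomorph (Euc n) (Euc n),
      Θ ∈ contDiffGroupoid ∞ (𝓡 n) ∧ x ∈ Θ.source ∧ (Θ : Euc n → Euc n) = θ := by
  have hc := hθ.self_of_nhds
  have hu : ∀ᶠ y in 𝓝 x, IsUnit (fderiv ℝ θ y) :=
    (contDiffAt_fderiv hc).continuousAt.eventually (Units.isOpen.mem_nhds hd)
  obtain ⟨s, hs, hso, hxs⟩ := eventually_nhds_iff.1 (hθ.and hu)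
  obtain ⟨U, hU⟩ := hd
  have hx : HasFDerivAt θ ((ContinuousLinearEquiv.ofUnit U : Euc n ≃L[ℝ] Euc n) :
      Euc n →L[ℝ] Euc n) x := by
    have := (hc.differentiableAt (by simp)).hasFDerivAt
    rw [← hU] at this
    exact this
  let Θ := (hc.toOpenPartialHomeomorph θ hx (by simp)).restrOpen s hso
  have hsrc : x ∈ Θ.source := ⟨hc.mem_toOpenPartialHomeomorph_source hx (by simp), hxs⟩
  refine ⟨Θ, ?_, hsrc, rfl⟩
  have hmem : ∀ y ∈ Θ.source, y ∈ s := fun y hy => hy.2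
  rw [contDiffGroupoid, mem_groupoid_of_pregroupoid]
  have h1 : ContDiffOn ℝ ∞ Θ Θ.source := fun y hy => (hs y (hmem y hy)).1.contDiffWithinAt
  have h2 : ContDiffOn ℝ ∞ Θ.symm Θ.target := fun y hy => by
    obtain ⟨g1, V, hV⟩ := hs _ (hmem _ (Θ.map_target hy))
    refine (Θ.contDiffAt_symm (f₀' := ContinuousLinearEquiv.ofUnit V) hy ?_ g1).contDiffWithinAt
    have := (g1.differentiableAt (by simp)).hasFDerivAt
    rw [← hV] at this
    exact this
  exact ⟨by simpa [contDiffPregroupoid] using h1, by simpa [contDiffPregroupoid] using h2⟩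

/-- Around every point there is a chart in which the coframe is radial to a given order. -/
theorem Parallelism.exists_radial_chart [IsManifold (𝓡 n) ∞ M] (w : Parallelism n M) (p : M)
    (m : ℕ) : ∃ e ∈ IsManifold.maximalAtlas (𝓡 n) ∞ M, (0 : Euc n) ∈ e.target ∧ e.symm 0 = p ∧
      w.coframe e 0 = 1 ∧ VanishesTo (m + 2) (fun y => w.coframe e y y - y) := by
  have he := IsManifold.chart_mem_maximalAtlas (I := 𝓡 n) (n := ∞) p
  set e := chartAt (Euc n) p
  have hp : p ∈ e.source := mem_chart_source _ p
  have hx := e.map_source hp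
  set x := e p with hxdef
  set W := w.frame e x with hW
  -- This affine map moves the point to the origin and, having the frame as its linear part, makes
  -- the coframe the identity there.
  set ι : Euc n → Euc n := fun y => x + W y with hι
  have cι : ∀ y, ContDiffAt ℝ ∞ ι y := fun y => contDiffAt_const.add W.contDiff.contDiffAt
  have dι : ∀ y, HasFDerivAt ι W y := fun y => W.hasFDerivAt.const_add x
  have hι0 : ι 0 = x := by simp [hι]
  have hιt : ∀ᶠ y in 𝓝 (0 : Euc n), ι y ∈ e.target :=
    (cι 0).continuousAt.eventually (by rw [hι0]; exact e.open_target.mem_nhds hx)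
  have cZ : ∀ᶠ y in 𝓝 (0 : Euc n), ContDiffAt ℝ ∞ (fun y => (w.coframe e (ι y)).comp W) y := by
    filter_upwards [hιt] with y hy
    exact (ContDiffAt.comp y (w.contDiffAt_coframe he hy) (cι y)).clm_comp contDiffAt_const
  obtain ⟨φ, cφ, h0, hd, hv⟩ := exists_radial cZ
    (by simp only [hι0]; exact w.coframe_mul_frame he hx) m
  have cθ : ∀ᶠ y in 𝓝 (0 : Euc n), ContDiffAt ℝ ∞ (fun y => ι (φ y)) y :=
    cφ.mono fun y hy => (cι _).comp y hy
  have dθ : ∀ᶠ y in 𝓝 (0 : Euc n), fderiv ℝ (fun y => ι (φ y)) y = W.comp (fderiv ℝ φ y) :=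
    cφ.mono fun y hy => ((dι _).comp y (hy.differentiableAt (by simp)).hasFDerivAt).fderiv
  obtain ⟨Θ, hΘ, hs, hΘθ⟩ := exists_mem_contDiffGroupoid cθ (by
    rw [dθ.self_of_nhds, hd]
    exact ⟨⟨W, w.coframe e x, w.frame_mul_coframe he hx, w.coframe_mul_frame he hx⟩, rfl⟩)
  have hΘ0 : Θ 0 = x := by rw [hΘθ]; simp [h0, hι0]
  have he' := trans_mem_maximalAtlas he (StructureGroupoid.symm _ hΘ)
  have ht : (0 : Euc n) ∈ (e.trans Θ.symm).target := by
    simp [hs, hΘ0, hx]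
  -- In the chart `e.trans Θ.symm` the change of coordinates back to `e` is ι ∘ φ, so the new
  -- coframe is the pull-back normalised by `exists_radial`.
  have key : ∀ᶠ y in 𝓝 (0 : Euc n), w.coframe (e.trans Θ.symm) y =
      ((w.coframe e (ι (φ y))).comp W).comp (fderiv ℝ φ y) := by
    filter_upwards [(e.trans Θ.symm).open_target.mem_nhds ht, dθ.eventually_nhds] with y hy hdy
    have hy' : Θ y ∈ e.target := by simp at hy; exact hy.2
    have h1 := w.coframe_transition he' he hy (e.map_target hy')
    have h2 : (fun y => e ((e.trans Θ.symm).symm y)) =ᶠ[𝓝 y] fun y => ι (φ y) := by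
      filter_upwards [(e.trans Θ.symm).open_target.mem_nhds hy] with z hz
      have hz' : Θ z ∈ e.target := by simp at hz; exact hz.2
      have : e ((e.trans Θ.symm).symm z) = Θ z := e.right_inv hz'
      rw [this, hΘθ]
    rw [h1, h2.fderiv_eq, show e ((e.trans Θ.symm).symm y) = ι (φ y) from h2.self_of_nhds, hdy.self_of_nhds]
    rfl
  refine ⟨_, he', ht, ?_, ?_, ?_⟩
  · change e.symm (Θ 0) = p
    rw [hΘ0, hxdef, e.left_inv hp]
  · rw [key.self_of_nhds, hd, h0, hι0]
    exact w.coframe_mul_frame he hx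
  · refine hv.congr ?_
    filter_upwards [key] with y hy
    rw [hy]
    rfl

end Radial

/-! ### Polynomial jets -/

section JetArithmetic

variable {E : Type} [NormedAddCommGroup E] [NormedSpace ℝ E] {K : ℕ}

/-- Agreement to order K is a congruence for products: fg - f'g' = (f - f')g + f'(g - g'). -/
theorem VanishesTo.mul_sub_mul {f f' g g' : E → ℝ} (cf : ContDiffAt ℝ ∞ f 0)
    (cf' : ContDiffAt ℝ ∞ f' 0) (cg : ContDiffAt ℝ ∞ g 0) (cg' : ContDiffAt ℝ ∞ g' 0)
    (hf : VanishesTo K (fun x => f x - f' x)) (hg : VanishesTo K (fun x => g x - g' x)) :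
    VanishesTo K (fun x => f x * g x - f' x * g' x) := by
  have h1 := VanishesTo.bilinear (ContinuousLinearMap.mul ℝ ℝ) hf (vanishesTo_zero g)
    (cf.sub cf') cg
  have h2 := VanishesTo.bilinear (ContinuousLinearMap.mul ℝ ℝ) (vanishesTo_zero f') hg cf'
    (cg.sub cg')
  rw [zero_add] at h2
  refine (h1.add h2 ((cf.sub cf').mul cg) (cf'.mul (cg.sub cg'))).congr
    (Eventually.of_forall fun x => ?_)
  simp only [ContinuousLinearMap.mul_apply']
  ring

theorem VanishesTo.prod_sub_prod {ι : Type*} (s : Finset ι) {f f' : ι → E → ℝ}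
    (cf : ∀ i, ContDiffAt ℝ ∞ (f i) 0) (cf' : ∀ i, ContDiffAt ℝ ∞ (f' i) 0)
    (hf : ∀ i, VanishesTo K (fun x => f i x - f' i x)) :
    VanishesTo K (fun x => ∏ i ∈ s, f i x - ∏ i ∈ s, f' i x) := by
  classical
  induction s using Finset.induction_on with
  | empty =>
    intro l _
    simp
  | insert i s hi ih =>
    simp only [Finset.prod_insert hi]
    exact VanishesTo.mul_sub_mul (cf i) (cf' i) (contDiffAt_prod fun j _ => cf j)
      (contDiffAt_prod fun j _ => cf' j) (hf i) ih

theorem VanishesTo.sum {F ι : Type} [NormedAddCommGroup F] [NormedSpace ℝ F] (s : Finset ι)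
    {f : ι → E → F} (cf : ∀ i, ContDiffAt ℝ ∞ (f i) 0) (hf : ∀ i, VanishesTo K (f i)) :
    VanishesTo K (fun x => ∑ i ∈ s, f i x) := by
  classical
  induction s using Finset.induction_on with
  | empty =>
    intro l _
    simp
  | insert i s hi ih =>
    simp only [Finset.sum_insert hi]
    exact (hf i).add ih (cf i) (ContDiffAt.sum fun j _ => cf j)

theorem VanishesTo.iteratedFDeriv_eq {f g : E → ℝ} (h : VanishesTo K (fun x => f x - g x))
    (cf : ContDiffAt ℝ ∞ f 0) (cg : ContDiffAt ℝ ∞ g 0) {l : ℕ} (hl : l < K) :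
    iteratedFDeriv ℝ l f 0 = iteratedFDeriv ℝ l g 0 := by
  have := iteratedFDeriv_sub_apply (i := l) (cf.of_le (by exact_mod_cast le_top))
    (cg.of_le (by exact_mod_cast le_top))
  rw [← sub_eq_zero, ← this]
  exact h l hl

end JetArithmetic

/-! ### Derivatives of polynomials with parameters -/

section Poly

variable {n : ℕ} {τ : Type*}

/-- Evaluation of a polynomial in the coordinates and in additional parameters. -/
noncomputable def evalAt (v : τ → ℝ) (x : Euc n) : MvPolynomial (Fin n ⊕ τ) ℝ →ₐ[ℝ] ℝ :=
  MvPolynomial.aeval (Sum.elim (fun i => x i) v)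

theorem contDiff_evalAt (v : τ → ℝ) (p : MvPolynomial (Fin n ⊕ τ) ℝ) :
    ContDiff ℝ ∞ fun x => evalAt v x p := by
  induction p using MvPolynomial.induction_on with
  | C a => simpa [evalAt] using contDiff_const
  | add p q hp hq => simpa using hp.add hq
  | mul_X p i hp =>
    simp only [map_mul]
    refine hp.mul ?_
    cases i with
    | inl i =>
      simp only [evalAt, MvPolynomial.aeval_X, Sum.elim_inl]
      exact (EuclideanSpace.proj i : Euc n →L[ℝ] ℝ).contDiff
    | inr i =>
      simp only [evalAt, MvPolynomial.aeval_X, Sum.elim_inr]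
      exact contDiff_const

theorem fderiv_evalAt (v : τ → ℝ) (p : MvPolynomial (Fin n ⊕ τ) ℝ) (x : Euc n) (j : Fin n) :
    fderiv ℝ (fun x => evalAt v x p) x (stdVec j) =
      evalAt v x (MvPolynomial.pderiv (Sum.inl j) p) := by
  have hd : ∀ p, DifferentiableAt ℝ (fun x => evalAt v x p) x := fun p =>
    (contDiff_evalAt v p).contDiffAt.differentiableAt (by simp)
  induction p using MvPolynomial.induction_on with
  | C a => simp [evalAt]
  | add p q hp hq =>
    simp only [map_add]
    rw [fderiv_fun_add (hd p) (hd q), add_apply, hp, hq]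
  | mul_X p i hp =>
    simp only [map_mul, Derivation.leibniz]
    rw [fderiv_fun_mul (hd p) (hd _), add_apply, smul_apply, smul_apply, hp]
    simp only [map_add, smul_eq_mul, map_mul]
    congr 2
    classical
    cases i with
    | inl i =>
      have : (fun x : Euc n => evalAt v x (MvPolynomial.X (Sum.inl i))) =
          (EuclideanSpace.proj i : Euc n →L[ℝ] ℝ) := by
        funext x; simp [evalAt]
      rw [this, ContinuousLinearMap.fderiv, MvPolynomial.pderiv_X]
      by_cases h : i = j
      · subst h; simp [stdVec_apply]
      · simp [stdVec_apply, h]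
    | inr i => simp [evalAt]

/-- Iterated partial derivatives of a polynomial with respect to the coordinates. -/
noncomputable def iterPderiv : {l : ℕ} → (Fin l → Fin n) → MvPolynomial (Fin n ⊕ τ) ℝ →
    MvPolynomial (Fin n ⊕ τ) ℝ
  | 0, _, p => p
  | _ + 1, m, p => MvPolynomial.pderiv (Sum.inl (m 0)) (iterPderiv (Fin.tail m) p)

theorem iteratedFDeriv_evalAt (v : τ → ℝ) (p : MvPolynomial (Fin n ⊕ τ) ℝ) {l : ℕ}
    (m : Fin l → Fin n) (x : Euc n) :
    iteratedFDeriv ℝ l (fun x => evalAt v x p) x (fun t => stdVec (m t)) =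
      evalAt v x (iterPderiv m p) := by
  induction l generalizing x with
  | zero => simp [iterPderiv]
  | succ l ih =>
    have hd : DifferentiableAt ℝ (iteratedFDeriv ℝ l fun x => evalAt v x p) x :=
      (contDiff_evalAt v p).contDiffAt.differentiableAt_iteratedFDeriv
        (by exact_mod_cast WithTop.coe_lt_top _)
    rw [hd.iteratedFDeriv_succ_apply_left']
    have : (fun y => iteratedFDeriv ℝ l (fun x => evalAt v x p) y
        (Fin.tail fun t => (stdVec (m t) : Euc n))) =
        fun y => evalAt v y (iterPderiv (Fin.tail m) p) := funext fun y => ih (Fin.tail m) y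
    rw [this, fderiv_evalAt]
    rfl

end Poly

/-! ### The universal polynomials -/

section RadialPoly

variable {n r s : ℕ}

/-- The matrix of `ad x`, with polynomial entries. -/
noncomputable def adPoly (n r s : ℕ) :
    Matrix (Fin n) (Fin n) (MvPolynomial (Fin n ⊕ Vars n r s) ℝ) :=
  Matrix.of fun i j => ∑ a, MvPolynomial.X (Sum.inr (Sum.inl (i, a, j))) *
    MvPolynomial.X (Sum.inl a)

/-- The components of an invariant tensor field in a radial chart, to finite order. -/
noncomputable def compPoly (K : ℕ) (I : Fin r → Fin n) (J : Fin s → Fin n) :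
    MvPolynomial (Fin n ⊕ Vars n r s) ℝ :=
  ∑ A : Fin r → Fin n, ∑ B : Fin s → Fin n, MvPolynomial.X (Sum.inr (Sum.inr (A, B))) *
    ((∏ i, expQuotInv K (adPoly n r s) (I i) (A i)) * ∏ j, expQuot K (adPoly n r s) (B j) (J j))

/-- The universal polynomials. -/
noncomputable def jetPoly (n r s k : ℕ) : PolyJet n r s k := fun _ m I J =>
  -- Setting the coordinates to 0 leaves a polynomial in C and the tensor components alone.
  -- Truncation at k + 1 suffices for derivatives of order at most k.
  MvPolynomial.aeval (Sum.elim (fun _ => 0) MvPolynomial.X) (iterPderiv m (compPoly (k + 1) I J))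

/-- The values of the variables. -/
def varVal (C : Fin n → Fin n → Fin n → ℝ) (a : Comps n r s) : Vars n r s → ℝ :=
  Sum.elim (fun v => C v.1 v.2.1 v.2.2) (fun v => a v.1 v.2)

theorem jetPoly_eval (k : ℕ) (C : Fin n → Fin n → Fin n → ℝ) (a : Comps n r s)
    (l : Fin (k + 1)) (m : Fin l → Fin n) (I : Fin r → Fin n) (J : Fin s → Fin n) :
    (jetPoly n r s k).eval C a l m I J =
      evalAt (varVal C a) (0 : Euc n) (iterPderiv m (compPoly (k + 1) I J)) := by
  have h : (MvPolynomial.aeval (varVal C a)).comp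
      (MvPolynomial.aeval (Sum.elim (fun _ => 0) MvPolynomial.X)) =
      evalAt (varVal C a) (0 : Euc n) := by
    ext i
    cases i <;> simp [evalAt]
  rw [← h]
  simp only [PolyJet.eval, jetPoly, AlgHom.comp_apply]
  rw [← MvPolynomial.coe_aeval_eq_eval]
  rfl

/-- The matrix of an endomorphism. -/
noncomputable def matrixHom (n : ℕ) : (Euc n →L[ℝ] Euc n) →ₐ[ℝ] Matrix (Fin n) (Fin n) ℝ :=
  ((LinearMap.toMatrixAlgEquiv (EuclideanSpace.basisFun (Fin n) ℝ).toBasis).toAlgHom).comp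
    { ContinuousLinearMap.toLinearMapRingHom with commutes' := fun _ => rfl }

theorem matrixHom_apply (L : Euc n →L[ℝ] Euc n) (i j : Fin n) :
    matrixHom n L i j = L (stdVec j) i := by
  refine (LinearMap.toMatrixAlgEquiv_apply (EuclideanSpace.basisFun (Fin n) ℝ).toBasis
    (L : Euc n →ₗ[ℝ] Euc n) i j).trans ?_
  simp [stdVec]

theorem matrixHom_bracket (C : Fin n → Fin n → Fin n → ℝ) (a : Comps n r s) (x : Euc n) :
    matrixHom n (bracket C x) = (evalAt (varVal C a) x).mapMatrix (adPoly n r s) := by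
  ext i j
  rw [matrixHom_apply, bracket_apply]
  simp [adPoly, evalAt, varVal, stdVec_apply]

theorem expQuot_bracket (C : Fin n → Fin n → Fin n → ℝ) (a : Comps n r s) (K : ℕ) (x : Euc n)
    (i j : Fin n) : expQuot K (bracket C x) (stdVec j) i =
      evalAt (varVal C a) x (expQuot K (adPoly n r s) i j) := by
  rw [← matrixHom_apply, map_expQuot, matrixHom_bracket C a, ← map_expQuot]
  rfl

theorem expQuotInv_bracket (C : Fin n → Fin n → Fin n → ℝ) (a : Comps n r s) (K : ℕ) (x : Euc n)
    (i j : Fin n) : expQuotInv K (bracket C x) (stdVec j) i =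
      evalAt (varVal C a) x (expQuotInv K (adPoly n r s) i j) := by
  rw [← matrixHom_apply, map_expQuotInv, matrixHom_bracket C a, ← map_expQuotInv]
  rfl

end RadialPoly

/-! ### Invariant tensor fields -/

section TensorAlgebra

variable {n r s : ℕ} {U V W : Type*} [AddCommGroup U] [Module ℝ U] [AddCommGroup V] [Module ℝ V]
  [AddCommGroup W] [Module ℝ W]

theorem Tensor.transport_apply (L : V ≃ₗ[ℝ] W) (t : Tensor r s V)
    (θ : Fin r → Module.Dual ℝ W) (v : Fin s → W) :
    t.transport L θ v = t (fun i => (θ i).comp (L : V →ₗ[ℝ] W)) (fun j => L.symm (v j)) := rfl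

theorem Tensor.transport_trans (L : U ≃ₗ[ℝ] V) (L' : V ≃ₗ[ℝ] W) (t : Tensor r s U) :
    t.transport (L.trans L') = (t.transport L).transport L' := rfl

theorem Tensor.transport_transport_symm (L : U ≃ₗ[ℝ] V) (t : Tensor r s U) :
    (t.transport L).transport L.symm = t := by
  ext θ v
  rw [transport_apply, transport_apply]
  congr 1
  · congr 1
    funext i
    ext u
    simp
  · funext j
    simp

theorem Tensor.apply_eq_sum (t : Tensor r s (Euc n)) (θ : Fin r → Module.Dual ℝ (Euc n))
    (v : Fin s → Euc n) :
    t θ v = ∑ A : Fin r → Fin n, ∑ B : Fin s → Fin n,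
      t.comps A B * ((∏ i, θ i (stdVec (A i))) * ∏ j, v j (B j)) := by
  have hθ : θ = fun i => ∑ a, θ i (stdVec a) • stdCovec a := by
    funext i
    ext u
    conv_lhs => rw [← sum_smul_stdVec u]
    simp [stdCovec, mul_comm]
  have hv : v = fun j => ∑ b, v j b • stdVec b := funext fun j => (sum_smul_stdVec _).symm
  have h1 : t θ = ∑ A : Fin r → Fin n, (∏ i, θ i (stdVec (A i))) • t fun i => stdCovec (A i) := by
    conv_lhs => rw [hθ]
    rw [MultilinearMap.map_sum]
    exact Finset.sum_congr rfl fun A _ => MultilinearMap.map_smul_univ _ _ _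
  rw [h1, sum_apply]
  refine Finset.sum_congr rfl fun A _ => ?_
  rw [smul_apply]
  conv_lhs => rw [hv]
  rw [MultilinearMap.map_sum, Finset.smul_sum]
  refine Finset.sum_congr rfl fun B _ => ?_
  rw [MultilinearMap.map_smul_univ, comps, smul_eq_mul, smul_eq_mul]
  ring

theorem Tensor.comps_injective : Function.Injective (Tensor.comps (n := n) (r := r) (s := s)) := by
  intro t t' h
  ext θ v
  rw [t.apply_eq_sum, t'.apply_eq_sum, h]

end TensorAlgebra

/-! ### Structure constants and jets of invariant fields -/

section Invariance

variable {n : ℕ} {M : Type*} [TopologicalSpace M] [ChartedSpace (Euc n) M]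
  (w : Parallelism n M) {r s : ℕ} {α : TensorField n M r s}

theorem TensorField.chartComps_eq (α : TensorField n M r s) (e : OpenPartialHomeomorph M (Euc n))
    (x : Euc n) (I : Fin r → Fin n) (J : Fin s → Fin n) :
    α.chartComps e x I J = (α (e.symm x)).transport (w.z (e.symm x))
      (fun i => (coordForm e x (I i)).comp (w.w (e.symm x) : Euc n →ₗ[ℝ] _))
      (fun j => w.z (e.symm x) (coordVec e x (J j))) := by
  rw [Tensor.transport_apply, chartComps]
  congr 1
  · congr 1
    funext i
    ext u
    simp [Parallelism.z]
  · funext j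
    simp

namespace Parallelism

theorem hasStructureConstants_of_isInvariant (h : w.IsInvariant α) (p : M) :
    w.HasStructureConstants α ((α p).transport (w.z p)).comps := by
  intro q
  rw [← h p q, eps, Tensor.transport_trans]
  exact congrArg Tensor.comps (Tensor.transport_transport_symm (w.w q) _)

/-- Invariance means that the tensor carried to ℝⁿ by z is the same at all points; the invariance of
β is obtained in this way. -/
theorem isInvariant_of_hasStructureConstants {a : Comps n r s}
    (h : w.HasStructureConstants α a) : w.IsInvariant α := by
  intro p q
  have h1 := Tensor.comps_injective ((h p).trans (h q).symm)
  rw [eps, Tensor.transport_trans, h1]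
  exact Tensor.transport_transport_symm (w.z q) _

/-- Carried to ℝⁿ, the coordinate forms become rows of the frame matrix and the coordinate vectors
columns of the coframe matrix. -/
theorem chartComps_eq_sum {a : Comps n r s} (h : w.HasStructureConstants α a)
    (e : OpenPartialHomeomorph M (Euc n)) (x : Euc n) (I : Fin r → Fin n) (J : Fin s → Fin n) :
    α.chartComps e x I J = ∑ A : Fin r → Fin n, ∑ B : Fin s → Fin n,
      a A B * ((∏ i, w.wC e (I i) (A i) x) * ∏ j, w.zC e (B j) (J j) x) := by
  rw [α.chartComps_eq w, Tensor.apply_eq_sum, h (e.symm x)]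
  rfl

theorem comps_eq_chartComps {e : OpenPartialHomeomorph M (Euc n)}
    (he : e ∈ IsManifold.maximalAtlas (𝓡 n) ∞ M) {x : Euc n} (hx : x ∈ e.target)
    (h1 : w.coframe e x = 1) (α : TensorField n M r s) :
    ((α (e.symm x)).transport (w.z (e.symm x))).comps = α.chartComps e x := by
  have h2 : w.frame e x = 1 := by
    rw [← w.frame_mul_coframe he hx, h1, mul_one]
  funext I J
  rw [α.chartComps_eq w, Tensor.comps]
  congr 1
  · congr 1
    funext i
    refine LinearMap.ext fun v => ?_
    have : w.frame e x v (I i) = v (I i) := by rw [h2]; rfl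
    exact this.symm
  · funext j
    have : w.coframe e x (stdVec (J j)) = stdVec (J j) := by rw [h1]; rfl
    exact this.symm

/-- In a radial chart, the jet of an invariant tensor field is given by universal polynomials. -/
theorem jet_chartComps {C : Fin n → Fin n → Fin n → ℝ} (hC : w.HasLieConstants C)
    {a : Comps n r s} (h : w.HasStructureConstants α a) {e : OpenPartialHomeomorph M (Euc n)}
    (he : e ∈ IsManifold.maximalAtlas (𝓡 n) ∞ M) (h0 : (0 : Euc n) ∈ e.target) {k : ℕ}
    (hrad : VanishesTo (k + 2) (fun y => w.coframe e y y - y)) :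
    jet k (α.chartComps e) 0 = (jetPoly n r s k).eval C a := by
  have cZ := w.contDiffAt_coframe he h0
  have cW := w.contDiffAt_frame he h0
  have cA : ContDiffAt ℝ ∞ (fun x => bracket C x) (0 : Euc n) := (bracket C).contDiff.contDiffAt
  have hZ : VanishesTo (k + 1) (fun x => w.coframe e x - expQuot (k + 1) (bracket C x)) := by
    refine vanishesTo_sub_expQuot (bracket C) cZ ?_ hrad
    filter_upwards [e.open_target.mem_nhds h0] with y hy using w.maurerCartan hC he hy
  have hW : VanishesTo (k + 1) (fun x => w.frame e x - expQuotInv (k + 1) (bracket C x)) := by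
    refine vanishesTo_sub_expQuotInv k.succ_pos cZ cW cA (map_zero _) ?_ hZ
    filter_upwards [e.open_target.mem_nhds h0] with y hy using w.frame_mul_coframe he hy
  have hentry (i j : Fin n) : ∃ L : (Euc n →L[ℝ] Euc n) →L[ℝ] ℝ, ∀ f, L f = f (stdVec j) i :=
    ⟨(EuclideanSpace.proj i : Euc n →L[ℝ] ℝ).comp
      (ContinuousLinearMap.apply ℝ (Euc n) (stdVec j)), fun _ => rfl⟩
  set v := varVal C a with hv
  have hz (i j : Fin n) : VanishesTo (k + 1) (fun x => w.zC e i j x -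
      evalAt v x (expQuot (k + 1) (adPoly n r s) i j)) := by
    obtain ⟨L, hL⟩ := hentry i j
    refine (hZ.clm_apply_left (cZ.sub (ContDiffAt.expQuot cA _)) L).congr
      (Eventually.of_forall fun x => ?_)
    beta_reduce
    rw [hL, zC_eq, ← expQuot_bracket C a]
    rfl
  have hw (i j : Fin n) : VanishesTo (k + 1) (fun x => w.wC e i j x -
      evalAt v x (expQuotInv (k + 1) (adPoly n r s) i j)) := by
    obtain ⟨L, hL⟩ := hentry i j
    refine (hW.clm_apply_left (cW.sub (ContDiffAt.expQuotInv cA _)) L).congr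
      (Eventually.of_forall fun x => ?_)
    beta_reduce
    rw [hL, wC_eq, ← expQuotInv_bracket C a]
    rfl
  have cz := w.contDiffAt_zC he h0
  have cw := w.contDiffAt_wC he h0
  have cp (p : MvPolynomial (Fin n ⊕ Vars n r s) ℝ) : ContDiffAt ℝ ∞ (fun x => evalAt v x p) 0 :=
    (contDiff_evalAt v p).contDiffAt
  funext l m I J
  have hcomp : (fun y => α.chartComps e y I J) = fun x => ∑ A : Fin r → Fin n,
      ∑ B : Fin s → Fin n, a A B * ((∏ i, w.wC e (I i) (A i) x) * ∏ j, w.zC e (B j) (J j) x) :=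
    funext fun x => w.chartComps_eq_sum h e x I J
  have hpoly : (fun x : Euc n => evalAt v x (compPoly (k + 1) I J)) = fun x =>
      ∑ A : Fin r → Fin n, ∑ B : Fin s → Fin n, a A B *
        ((∏ i, evalAt v x (expQuotInv (k + 1) (adPoly n r s) (I i) (A i))) *
          ∏ j, evalAt v x (expQuot (k + 1) (adPoly n r s) (B j) (J j))) := by
    funext x
    simp only [compPoly, map_sum, map_mul, map_prod]
    simp [evalAt, hv, varVal]
  have c1 (A : Fin r → Fin n) (B : Fin s → Fin n) : ContDiffAt ℝ ∞
      (fun x => a A B * ((∏ i, w.wC e (I i) (A i) x) * ∏ j, w.zC e (B j) (J j) x)) 0 :=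
    contDiffAt_const.mul ((contDiffAt_prod fun i _ => cw _ _).mul (contDiffAt_prod fun i _ => cz _ _))
  have c2 (A : Fin r → Fin n) (B : Fin s → Fin n) : ContDiffAt ℝ ∞ (fun x => a A B *
      ((∏ i, evalAt v x (expQuotInv (k + 1) (adPoly n r s) (I i) (A i))) *
          ∏ j, evalAt v x (expQuot (k + 1) (adPoly n r s) (B j) (J j)))) 0 :=
    contDiffAt_const.mul ((contDiffAt_prod fun i _ => cp _).mul (contDiffAt_prod fun i _ => cp _))
  -- Each entry of the frame and the coframe agrees with its polynomial to order k + 1, and sums and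
  -- products preserve this.
  have key : VanishesTo (k + 1) (fun x => α.chartComps e x I J -
      evalAt v x (compPoly (k + 1) I J)) := by
    have h1 (A : Fin r → Fin n) (B : Fin s → Fin n) := VanishesTo.mul_sub_mul (K := k + 1)
      (f := fun _ : Euc n => a A B) (f' := fun _ => a A B)
      contDiffAt_const contDiffAt_const
      ((contDiffAt_prod fun i _ => cw (I i) (A i)).mul
        (contDiffAt_prod (t := Finset.univ) fun j _ => cz (B j) (J j)))
      ((contDiffAt_prod fun i _ => cp _).mul (contDiffAt_prod fun i _ => cp _))
      (fun l _ => by simp)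
      (VanishesTo.mul_sub_mul (contDiffAt_prod fun i _ => cw (I i) (A i))
        (contDiffAt_prod fun i _ => cp _) (contDiffAt_prod fun j _ => cz (B j) (J j))
        (contDiffAt_prod fun i _ => cp _)
        (VanishesTo.prod_sub_prod Finset.univ (fun i => cw (I i) (A i)) (fun i => cp _)
          fun i => hw (I i) (A i))
        (VanishesTo.prod_sub_prod Finset.univ (fun j => cz (B j) (J j)) (fun i => cp _)
          fun j => hz (B j) (J j)))
    have h2 := VanishesTo.sum Finset.univ (fun A => ContDiffAt.sum fun B _ => (c1 A B).sub (c2 A B))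
      fun A => VanishesTo.sum Finset.univ (fun B => (c1 A B).sub (c2 A B)) fun B => h1 A B
    refine h2.congr (Eventually.of_forall fun x => ?_)
    have e1 : α.chartComps e x I J = _ := congrFun hcomp x
    have e2 : evalAt v x (compPoly (k + 1) I J) = _ := congrFun hpoly x
    beta_reduce
    rw [e1, e2]
    simp only [Finset.sum_sub_distrib]
  rw [jetPoly_eval, ← hv, ← iteratedFDeriv_evalAt, jet, key.iteratedFDeriv_eq ?_ (cp _) l.2]
  rw [hcomp]
  exact ContDiffAt.sum fun A _ => ContDiffAt.sum fun B _ => c1 A B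

end Parallelism

end Invariance

end LLG

theorem proposition1 (n r s k : ℕ) :
    ∃ P : LLG.PolyJet n r s k,
      ∀ (r' s' : ℕ) (F : LLG.Jet n r s k → LLG.Comps n r' s')
        (M : Type*) [TopologicalSpace M] [ChartedSpace (LLG.Euc n) M]
        [IsManifold (𝓡 n) ∞ M] [ConnectedSpace M]
        (w : LLG.Parallelism n M), w.IsLocalLieGroup →
        ∀ (α : LLG.TensorField n M r s) (β : LLG.TensorField n M r' s'),
          w.IsInvariant α → LLG.IsTdi k F α β →
            w.IsInvariant β ∧
              ∃ (C : Fin n → Fin n → Fin n → ℝ) (a : LLG.Comps n r s),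
                w.HasLieConstants C ∧ LLG.IsLieAlgebra C ∧
                w.HasStructureConstants α a ∧
                w.HasStructureConstants β (F (P.eval C a)) := by
  refine ⟨LLG.jetPoly n r s k, ?_⟩
  intro r' s' F M _ _ _ _ w hw α β hα hβ
  obtain ⟨C, hC⟩ := w.exists_hasLieConstants hw
  obtain ⟨p₀⟩ : Nonempty M := inferInstance
  have ha := w.hasStructureConstants_of_isInvariant hα p₀
  set a := ((α p₀).transport (w.z p₀)).comps
  have hb : w.HasStructureConstants β (F ((LLG.jetPoly n r s k).eval C a)) := by
    intro p
    -- The chart depends on p, but the resulting jet, and hence the value of F, does not.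
    obtain ⟨e, he, h0, rfl, h1, hrad⟩ := w.exists_radial_chart p k
    rw [w.comps_eq_chartComps he h0 h1, hβ e he 0 h0, w.jet_chartComps hC ha he h0 hrad]
  exact ⟨w.isInvariant_of_hasStructureConstants hb, C, a, hC, w.isLieAlgebra hC, ha, hb⟩
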